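/- **Setting.** Let $0<T<\infty$, $a<b$, and let $E$ be the Hilbert space of absolutely continuous $f:[a,b]\to\mathbb R$ with $f(a)=0$ and $\|f\|_E^2=\int_a^b|f'(x)|^2dx<\infty$. Let $d\ge1$, $\lambda_1,\dots,\lambda_d\in E$, let $Z=(Z^1,\dots,Z^d)$ be measurable processes on $[0,T]$ with almost surely continuous paths on a probability space, let $\phi_t\in E$ be known, and $r_t=\phi_t+\sum_{j=1}^d Z^j_t\lambda_j$. One observes $r_t+\varepsilon_t$, where the error curves $\varepsilon_t=\varepsilon^{n,N}_t\in E$ may (but need not) depend on $(n,N)$; put $X_t=r_t+\varepsilon_t-\phi_t=\sum_jZ^j_t\lambda_j+\varepsilon_t$. Time points $(t_i)_{i\le\bar n}$ in $[0,T]$ and space points $(x_j)_{j\le\bar N}$ in $[a,b]$ are equidistant samplings (depending on $n$, resp. $N$) with meshes $\rho=\rho(n)\to0$, $\delta=\delta(N)\to0$ as $n,N\to\infty$, whose extreme points lie within one mesh of the ends of the interval. Write $\lambda(x)=(\lambda_1(x),\dots,\lambda_d(x))^\top$, $\mathbb X=(X_{t_i}(x_j))_{i,j}$, $\Sigma_Z=(\int_0^TZ^i_tZ^j_tdt)_{i,j}$,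 $\Sigma_\lambda=(\int_a^b\lambda_i\lambda_j\,dx)_{i,j}$, $\gamma_N(t_i,t_k)=\delta\,\mathbb E\sum_l\varepsilon_{t_i}(x_l)\varepsilon_{t_k}(x_l)$. **Assumptions.** (D1) $\rho\sum_iZ_{t_i}Z_{t_i}^\top\to\Sigma_Z$ in probability, and $\Sigma_Z$ is positive definite a.s. (D2) $\sup_{N,j}\|\lambda(x_j)\|<\infty$, $\delta\sum_j\lambda(x_j)\lambda(x_j)^\top\to\Sigma_\lambda$, and $\Sigma_\lambda$ is positive definite. (D3) $\mathbb E\varepsilon_{t_i}(x_j)=0$; $\mathbb E\max_{i,j}|\varepsilon_{t_i}(x_j)|^8<\infty$ for all $n,N$; the following are bounded uniformly in $n,N$ and in $i,k$: $\gamma_N(t_i,t_i)$; $\rho\sum_{i,k}|\gamma_N(t_i,t_k)|$; $\delta\sum_{l,m}\max_i|\mathbb E\varepsilon_{t_i}(x_l)\varepsilon_{t_i}(x_m)|$; $\delta\rho\sum_{i,k}\sum_{l,m}|\mathbb E\varepsilon_{t_i}(x_l)\varepsilon_{t_k}(x_m)|$; $\mathbb E\big|\delta^{1/2}\sum_l[\varepsilon_{t_i}(x_l)\varepsilon_{t_k}(x_l)-\mathbb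 E\varepsilon_{t_i}(x_l)\varepsilon_{t_k}(x_l)]\big|^4$; and $\varepsilon$ is independent of $Z$. (D4) The quantities $\mathbb E\big\|\sqrt{\rho\delta}\sum_{i,j}Z_{t_i}[\varepsilon_{t_i}(x_j)\varepsilon_{t_s}(x_j)-\mathbb E\varepsilon_{t_i}(x_j)\varepsilon_{t_s}(x_j)]\big\|^2$ and $\mathbb E\big|\sqrt{\rho\delta}\sum_{i,j}Z_{t_i}^\top\lambda(x_j)\varepsilon_{t_i}(x_j)\big|^2$ are bounded uniformly in $n,N,s$. (Q1) $\Sigma_\lambda\Sigma_Z$ has $d$ distinct eigenvalues a.s. **Estimators.** For all $n,N$ and scenarios let $y^1,y^2,\dots$ be orthonormal eigenvectors of $\mathbb X\mathbb X^\top$ ordered by decreasing eigenvalues, $\hat Y_{t_i,j}(k)=\rho^{-1/2}y^j_{t_i}$ ($j\le k$), and $$PC(k)=\min_{L\in\mathbb R^{\bar N\times k}}\rho\delta\sum_{i,j}\Big(X_{t_i}(x_j)-\sum_{l\le k}L_{jl}\hat Y_{t_i,l}(k)\Big)^2+k\,q(n,N),$$ where $q(n,N)\to0$ and $\min\{\delta^{-1/2},\rho^{-1/2}\}\,q(n,N)\to\infty$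 as $n,N\to\infty$. Let $\hat d$ be any minimizer of $PC$ over $1\le k\le k_{\max}$, where $k_{\max}\ge d$ is fixed, and let $\hat\varphi_j=\sqrt{\rho}\sum_ky^j_{t_k}X_{t_k}$. (Q5) $\sup_{0\le t\le T}\|\varepsilon_t\|_E^2$ is bounded in probability (uniformly in $n,N$), and $\rho\sum_{l<s}|y^i_{t_l}y^i_{t_s}|\,\|\varepsilon_{t_l}\|_E\|\varepsilon_{t_s}\|_E\to0$ in probability for $i=1,\dots,d$. **Limit.** Let $c_1\ge\dots\ge c_d$ be the eigenvalues of $\Sigma_\lambda\Sigma_Z$ (equivalently of $\Sigma_\lambda^{1/2}\Sigma_Z\Sigma_\lambda^{1/2}$), $\mathcal C=\mathrm{diag}(c_1,\dots,c_d)$, $\Phi$ an orthogonal matrix whose $j$-th column is an eigenvector of $\Sigma_\lambda^{1/2}\Sigma_Z\Sigma_\lambda^{1/2}$ for $c_j$, $G=\mathcal C^{1/2}\Phi^\top\Sigma_\lambda^{-1/2}$, $\mathcal A=\mathcal C^{-1}G\Sigma_\lambda$, and $\xi_j=((\mathcal A^{-1})^\top\lambda)_j$ for $j\le d$ (and $\xi_j=0$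 for $j>d$). **Proposition.** Under D1–D4, Q1 and Q5, $\mathbb P(\hat d\ne d)\to0$ and, if the signs of the eigenvectors $y^j$ (which are determined only up to sign) are suitably chosen, that is, for suitable random signs $s_j=s_j^{n,N}\in\{-1,1\}$, $$\sum_{j=1}^{\hat d}\|s_j\hat\varphi_j-\xi_j\|_E^2\to0\quad\text{in probability as } n,N\to\infty .$$ -/

import Mathlib

open MeasureTheory ProbabilityTheory Filter Topology Set
open scoped Matrix

noncomputable section

/-! ### The state space: absolutely continuous curves vanishing at `a`, with derivative in `L²` -/

/-- `f` belongs to the Sobolev space `E` on `[a, b]`: it is absolutely continuous on `[a, b]`,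
`f a = 0`, and its (almost everywhere defined) derivative is square integrable. -/
structure MemSobolev (a b : ℝ) (f : ℝ → ℝ) : Prop where
  absCont : AbsolutelyContinuousOnInterval f a b
  zero_left : f a = 0
  deriv_sq : IntervalIntegrable (fun x => (deriv f x) ^ 2) volume a b

/-- `‖f‖²_E = ∫_a^b |f'(x)|² dx`. -/
def sobolevNormSq (a b : ℝ) (f : ℝ → ℝ) : ℝ := ∫ x in a..b, (deriv f x) ^ 2

/-- `‖f‖_E`. -/
def sobolevNorm (a b : ℝ) (f : ℝ → ℝ) : ℝ := √(sobolevNormSq a b f)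

/-! ### Sampling grids -/

/-- A sequence of equidistant samplings of `[lo, hi]` whose mesh tends to zero. The grid may or may
not contain the two end points: `t_0 = lo, …, t_m = hi`, or the same without `t_0`, are covered. -/
structure UniformGrid (lo hi : ℝ) where
  /-- number of sampling points -/
  num : ℕ → ℕ
  /-- distance of consecutive sampling points -/
  mesh : ℕ → ℝ
  /-- first sampling point -/
  start : ℕ → ℝ
  num_pos : ∀ n, 0 < num n
  mesh_pos : ∀ n, 0 < mesh n
  lo_le_start : ∀ n, lo ≤ start n
  start_le : ∀ n, start n ≤ lo + mesh n
  last_le : ∀ n, start n + ((num n : ℝ) - 1) * mesh n ≤ hi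
  le_last : ∀ n, hi - mesh n ≤ start n + ((num n : ℝ) - 1) * mesh n
  mesh_tendsto : Tendsto mesh atTop (𝓝 0)

/-- The sampling points. -/
def UniformGrid.pt {lo hi : ℝ} (g : UniformGrid lo hi) (n : ℕ) (i : Fin (g.num n)) : ℝ :=
  g.start n + (i : ℝ) * g.mesh n

/-! ### Ordered eigenvectors -/

/-- `v` is an orthonormal system of eigenvectors of the `m × m` matrix `A`, where `v j` belongs to
the `j`-th largest eigenvalue `c j` (with multiplicity, counted from `0`). -/
structure IsOrderedEigensystem {m : ℕ} (A : Matrix (Fin m) (Fin m) ℝ)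
    (c : Fin m → ℝ) (v : Fin m → Fin m → ℝ) : Prop where
  antitone : Antitone c
  orthonormal : ∀ i j, v i ⬝ᵥ v j = if i = j then 1 else 0
  eigen : ∀ j, A *ᵥ v j = c j • v j

/-! ### The factor model -/

/-- The space-time factor model `r_t = φ_t + ∑_j Z^j_t λ_j`, observed with error. The error
`eps n N` may depend on the sampling frequencies `(n, N)`; an error process that does not is the
special case of a constant family. -/
structure FactorModel {Ω : Type*} [MeasurableSpace Ω] (P : Measure Ω) (d : ℕ) where
  T : ℝ
  a : ℝ
  b : ℝ
  T_pos : 0 < T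
  a_lt_b : a < b
  /-- time sampling `(t_i)`, mesh `ρ(n)` -/
  time : UniformGrid 0 T
  /-- space sampling `(x_j)`, mesh `δ(N)` -/
  space : UniformGrid a b
  /-- parametrization `φ_t(x)` -/
  phi : ℝ → ℝ → ℝ
  phi_mem : ∀ t ∈ Icc 0 T, MemSobolev a b (phi t)
  /-- loadings `λ_j(x)` -/
  lam : Fin d → ℝ → ℝ
  lam_mem : ∀ j, MemSobolev a b (lam j)
  /-- factors `Z_t^j(ω)` -/
  Z : ℝ → Ω → Fin d → ℝ
  Z_measurable : ∀ t ∈ Icc 0 T, Measurable (Z t)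
  Z_continuous : ∀ᵐ ω ∂P, ContinuousOn (fun t => Z t ω) (Icc 0 T)
  /-- errors `ε_t(ω)(x)` -/
  eps : ℕ → ℕ → ℝ → Ω → ℝ → ℝ
  eps_mem : ∀ n N, ∀ t ∈ Icc 0 T, ∀ ω, MemSobolev a b (eps n N t ω)
  eps_measurable : ∀ n N, ∀ t ∈ Icc 0 T, ∀ x ∈ Icc a b, Measurable (fun ω => eps n N t ω x)

namespace FactorModel

variable {Ω : Type*} [MeasurableSpace Ω] {P : Measure Ω} {d : ℕ} (m : FactorModel P d)

/-- `r_t(x) = φ_t(x) + ∑_j Z^j_t λ_j(x)`. -/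
def r (t : ℝ) (ω : Ω) (x : ℝ) : ℝ := m.phi t x + ∑ j, m.Z t ω j * m.lam j x

/-- The observed curves after subtraction of the known parametrization: `r_t + ε_t - φ_t`. -/
def obs (n N : ℕ) (t : ℝ) (ω : Ω) (x : ℝ) : ℝ := m.r t ω x + m.eps n N t ω x - m.phi t x

/-- `Z_{t_i}`. -/
def Zs (n : ℕ) (i : Fin (m.time.num n)) (ω : Ω) : Fin d → ℝ := m.Z (m.time.pt n i) ω

/-- `λ_k(x_j)`. -/
def lams (N : ℕ) (j : Fin (m.space.num N)) (k : Fin d) : ℝ := m.lam k (m.space.pt N j)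

/-- `ε_{t_i}(x_j)`. -/
def err (n N : ℕ) (i : Fin (m.time.num n)) (j : Fin (m.space.num N)) (ω : Ω) : ℝ :=
  m.eps n N (m.time.pt n i) ω (m.space.pt N j)

/-- `‖ε_{t_i}‖_E`. -/
def errNorm (n N : ℕ) (i : Fin (m.time.num n)) (ω : Ω) : ℝ :=
  sobolevNorm m.a m.b (m.eps n N (m.time.pt n i) ω)

/-- `E[ε_{t_i}(x_j) ε_{t_k}(x_l)]`. -/
def errCov (n N : ℕ) (i : Fin (m.time.num n)) (j : Fin (m.space.num N))
    (k : Fin (m.time.num n)) (l : Fin (m.space.num N)) : ℝ :=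
  ∫ ω, m.err n N i j ω * m.err n N k l ω ∂P

/-- `γ_N(t_i, t_k) = δ(N) E⟨ε_{t_i}, ε_{t_k}⟩`. -/
def gammaN (n N : ℕ) (i k : Fin (m.time.num n)) : ℝ :=
  m.space.mesh N * ∫ ω, ∑ l, m.err n N i l ω * m.err n N k l ω ∂P

/-- `Σ_Z`, the random Gram matrix of the factors in `L²[0, T]`. -/
def sigmaZ (ω : Ω) : Matrix (Fin d) (Fin d) ℝ :=
  Matrix.of fun i j => ∫ t in (0 : ℝ)..m.T, m.Z t ω i * m.Z t ω j

/-- `Σ_λ`, the Gram matrix of the loadings in `L²[a, b]`. -/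
def sigmaLam : Matrix (Fin d) (Fin d) ℝ :=
  Matrix.of fun i j => ∫ x in m.a..m.b, m.lam i x * m.lam j x

/-! ### Assumptions -/

structure D1 : Prop where
  tendsto : ∀ j k, TendstoInMeasure P
    (fun n ω => m.time.mesh n * ∑ i, m.Zs n i ω j * m.Zs n i ω k) atTop
    (fun ω => m.sigmaZ ω j k)
  posDef : ∀ᵐ ω ∂P, (m.sigmaZ ω).PosDef

structure D2 : Prop where
  bounded : ∃ C : ℝ, ∀ N j, √(∑ k, m.lams N j k ^ 2) ≤ C
  tendsto : Tendsto
    (fun N => m.space.mesh N • ∑ j, Matrix.vecMulVec (m.lams N j) (m.lams N j)) atTop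
    (𝓝 m.sigmaLam)
  posDef : m.sigmaLam.PosDef

structure D3 : Prop where
  mean_zero : ∀ n N i j, ∫ ω, m.err n N i j ω ∂P = 0
  moment_eight : ∀ n N, ∫⁻ ω, ⨆ i, ⨆ j, ENNReal.ofReal (|m.err n N i j ω| ^ 8) ∂P < ⊤
  gamma_diag : ∃ C : ℝ, ∀ n N i, m.gammaN n N i i ≤ C
  gamma_sum : ∃ C : ℝ, ∀ n N, m.time.mesh n * ∑ i, ∑ k, |m.gammaN n N i k| ≤ C
  cov_space : ∃ C : ℝ, ∀ n N,
    m.space.mesh N * ∑ l, ∑ j, (⨆ i, |m.errCov n N i j i l|) ≤ C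
  cov_space_time : ∃ C : ℝ, ∀ n N,
    m.space.mesh N * m.time.mesh n * ∑ i, ∑ k, ∑ l, ∑ j, |m.errCov n N i l k j| ≤ C
  moment_four : ∃ C : ℝ, ∀ n N i k,
    ∫⁻ ω, ENNReal.ofReal (|√(m.space.mesh N) *
      ∑ l, (m.err n N i l ω * m.err n N k l ω - m.errCov n N i l k l)| ^ 4) ∂P ≤ ENNReal.ofReal C
  /-- the whole error field is independent of the whole factor process -/
  indep : ∀ n N, IndepFun
    (fun ω (t : Icc (0 : ℝ) m.T) => m.Z t ω)
    (fun ω (p : Icc (0 : ℝ) m.T × Icc m.a m.b) => m.eps n N p.1 ω p.2) P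

structure D4 : Prop where
  cross : ∃ C : ℝ, ∀ n N s,
    ∫⁻ ω, ENNReal.ofReal (∑ k, (√(m.time.mesh n * m.space.mesh N) *
      ∑ i, ∑ j, m.Zs n i ω k *
        (m.err n N i j ω * m.err n N s j ω - m.errCov n N i j s j)) ^ 2) ∂P ≤ ENNReal.ofReal C
  loading : ∃ C : ℝ, ∀ n N,
    ∫⁻ ω, ENNReal.ofReal ((√(m.time.mesh n * m.space.mesh N) *
      ∑ i, ∑ j, (m.Zs n i ω ⬝ᵥ m.lams N j) * m.err n N i j ω) ^ 2) ∂P ≤ ENNReal.ofReal C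

/-- `Σ_λ Σ_Z` has `d` distinct eigenvalues almost surely. -/
def Q1 : Prop := ∀ᵐ ω ∂P, (spectrum ℝ (m.sigmaLam * m.sigmaZ ω)).ncard = d

/-! ### Estimators -/

/-- The data matrix `𝕏 = (X_{t_i}(x_j))`. -/
def data (n N : ℕ) (ω : Ω) : Matrix (Fin (m.time.num n)) (Fin (m.space.num N)) ℝ :=
  Matrix.of fun i j => m.obs n N (m.time.pt n i) ω (m.space.pt N j)

/-- A selection of vectors in the sampled time domain, `v n N ω j i` for `y^j_{t_i}`. -/
abbrev Selection :=
  (n N : ℕ) → Ω → Fin (m.time.num n) → Fin (m.time.num n) → ℝ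

/-- `y` selects, for all sample sizes and scenarios, an orthonormal system of eigenvectors of
`𝕏 𝕏ᵀ` ordered by decreasing eigenvalues. -/
def IsPrincipal (y : m.Selection) : Prop :=
  ∀ n N ω, ∃ c, IsOrderedEigensystem (m.data n N ω * (m.data n N ω)ᵀ) c (y n N ω)

/-- `y^j_{t_i}` for a natural number `j`, counted from `0`; zero if there are at most `j`
sampling times. -/
def comp (y : m.Selection) (n N : ℕ) (ω : Ω) (j : ℕ) (i : Fin (m.time.num n)) : ℝ :=
  if h : j < m.time.num n then y n N ω ⟨j, h⟩ i else 0

/-- The factor estimator `Ŷ_{t_i}(k) = ρ(n)^{-1/2} (y^1_{t_i}, …, y^k_{t_i})`. -/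
def Yhat (y : m.Selection) (n N : ℕ) (ω : Ω) (k : ℕ) : Matrix (Fin (m.time.num n)) (Fin k) ℝ :=
  Matrix.of fun i j => (√(m.time.mesh n))⁻¹ * m.comp y n N ω j i

/-- `V(k, Ŷ(k))`, the least squares residual over all `N × k` loading matrices. -/
def residual (y : m.Selection) (n N : ℕ) (ω : Ω) (k : ℕ) : ℝ :=
  ⨅ L : Matrix (Fin (m.space.num N)) (Fin k) ℝ,
    m.time.mesh n * m.space.mesh N *
      ∑ i, ∑ j, (m.data n N ω i j - L j ⬝ᵥ m.Yhat y n N ω k i) ^ 2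

/-- The information criterion `PC(k) = V(k, Ŷ(k)) + k q(n, N)`. -/
def PC (y : m.Selection) (q : ℕ → ℕ → ℝ) (n N : ℕ) (ω : Ω) (k : ℕ) : ℝ :=
  m.residual y n N ω k + k * q n N

/-- `d̂` minimizes `PC(k)` over `1 ≤ k ≤ kmax`. -/
def IsDimEstimator (y : m.Selection) (q : ℕ → ℕ → ℝ) (kmax : ℕ)
    (dhat : ℕ → ℕ → Ω → ℕ) : Prop :=
  ∀ n N ω, dhat n N ω ∈ Icc 1 kmax ∧
    ∀ k ∈ Icc 1 kmax, m.PC y q n N ω (dhat n N ω) ≤ m.PC y q n N ω k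

/-- `C_{nN} = min {δ(N)^{-1/2}, ρ(n)^{-1/2}}`. -/
def rate (n N : ℕ) : ℝ := min (√(m.space.mesh N))⁻¹ (√(m.time.mesh n))⁻¹

/-- `q(n, N) → 0` and `C_{nN} q(n, N) → ∞` as `n, N → ∞`. -/
structure IsPenalty (q : ℕ → ℕ → ℝ) : Prop where
  tendsto_zero : Tendsto (fun p : ℕ × ℕ => q p.1 p.2) atTop (𝓝 0)
  rate_mul : Tendsto (fun p : ℕ × ℕ => m.rate p.1 p.2 * q p.1 p.2) atTop atTop

/-- The estimated loadings `φ̂_j = √ρ(n) ∑_k y^j_{t_k} X_{t_k}`. -/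
def phiHat (y : m.Selection) (n N : ℕ) (ω : Ω) (j : ℕ) (x : ℝ) : ℝ :=
  √(m.time.mesh n) * ∑ k, m.comp y n N ω j k * m.obs n N (m.time.pt n k) ω x

structure Q5 (y : m.Selection) : Prop where
  /-- `sup_t ‖ε_t‖²_E` is bounded in probability -/
  bounded : ∀ η : ENNReal, 0 < η → ∃ K : ℝ, ∀ n N,
    P {ω | ∃ t ∈ Icc 0 m.T, K < sobolevNormSq m.a m.b (m.eps n N t ω)} ≤ η
  tendsto : ∀ i : Fin d, TendstoInMeasure P
    (fun (p : ℕ × ℕ) ω => m.time.mesh p.1 * ∑ l, ∑ s, if l < s then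
      |m.comp y p.1 p.2 ω i l * m.comp y p.1 p.2 ω i s|
        * m.errNorm p.1 p.2 l ω * m.errNorm p.1 p.2 s ω else 0)
    atTop (fun _ => 0)

/-! ### The limiting loadings -/

open scoped MatrixOrder Matrix.Norms.L2Operator in
/-- `Σ_λ^{1/2}`, the positive semidefinite square root. -/
def rootLam : Matrix (Fin d) (Fin d) ℝ := CFC.sqrt m.sigmaLam

/-- `c` lists the eigenvalues of `Σ_λ Σ_Z` in decreasing order, through the symmetric matrix
`Σ_λ^{1/2} Σ_Z Σ_λ^{1/2}` that has the same eigenvalues, and `Φ` has corresponding orthonormal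
eigenvectors of the latter as its columns. -/
def IsLimitEigensystem (c : Ω → Fin d → ℝ) (Φ : Ω → Matrix (Fin d) (Fin d) ℝ) : Prop :=
  ∀ ω, IsOrderedEigensystem (m.rootLam * m.sigmaZ ω * m.rootLam) (c ω) (Φ ω)ᵀ

/-- `G = 𝒞^{1/2} Φᵀ Σ_λ^{-1/2}` with `𝒞 = diag (c_1, …, c_d)`. -/
def G (c : Fin d → ℝ) (Φ : Matrix (Fin d) (Fin d) ℝ) : Matrix (Fin d) (Fin d) ℝ :=
  Matrix.diagonal (fun i => √(c i)) * Φᵀ * m.rootLam⁻¹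

/-- `𝒜 = 𝒞⁻¹ G Σ_λ`. -/
def rotation (c : Fin d → ℝ) (Φ : Matrix (Fin d) (Fin d) ℝ) : Matrix (Fin d) (Fin d) ℝ :=
  Matrix.diagonal (fun i => (c i)⁻¹) * m.G c Φ * m.sigmaLam

/-- `ξ_j = ((𝒜⁻¹)ᵀ λ)_j`, counted from `0`; zero for `j ≥ d`. -/
def xi (c : Fin d → ℝ) (Φ : Matrix (Fin d) (Fin d) ℝ) (j : ℕ) (x : ℝ) : ℝ :=
  if h : j < d then (((m.rotation c Φ)⁻¹)ᵀ *ᵥ fun k => m.lam k x) ⟨j, h⟩ else 0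

end FactorModel

end

/-! After scaling by `√(ρδ)` the data matrix is `D = F Bᵀ + E`: `F` holds the sampled factors, `B`
the sampled loadings, `E` the errors. As `Bᵀ B → Σ_λ` and `E` contributes little, `D Dᵀ` is close in
Frobenius norm to `A Aᵀ`, where `A = F Σ_λ^{1/2}` has only `d` columns, and `Aᵀ A` is close to `H =
Σ_λ^{1/2} Σ_Z Σ_λ^{1/2}` by D1.

Dimension (`dim_eq`). The least squares residual is `‖D‖² - ∑_{l<k} μ_l` with `μ_l` the ordered
eigenvalues of `D Dᵀ`, so admitting component `l` changes `PC` by `q - μ_l`. Counting from `0`, it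
remains to see `μ_d < q < μ_{d-1}`. From below, `μ_{d-1}` stays away from `0` because `H` is
positive definite (`le_eigenvalue_low_rank`). From above, the min-max principle with a test vector
killed by `Fᵀ` leaves only the errors, so `μ_d ≤ ‖E Eᵀ‖`; the moment bounds give `𝔼‖E Eᵀ‖² = O(ρ +
δ)`, which is `o(q²)`.

Loadings (`tendsto_score`). If `y_j` are the eigenvectors of `D Dᵀ`, the scores `w_j = Aᵀ y_j ∈ ℝ^d`
are nearly orthogonal, have squared length close to `μ_j`, and are nearly eigenvectors of `H`. The
eigenvalues `c_j` of `H` are simple, so up to sign `w_j` must be close to `√c_j φ_j`. This follows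
by compactness from the exact case rather than from a perturbation bound. The estimated and limiting
loadings have `λ`-coefficients `Σ_λ^{-1/2} w_j` and `Σ_λ^{-1/2} √c_j φ_j`; what remains of the
estimate is a weighted sum of error curves, controlled by Q5.

Probability enters through the filter `whp`, along which convergence in probability is an ordinary
limit. The eigenvalue gaps of `H` are random and have no uniform lower bound; therefore all limits
are taken on events `separatedEvent k` that exhaust the space. -/

noncomputable section

/-! ### Events of probability tending to one, as a filter -/

section WithHighProbability

variable {ι Ω : Type*} [MeasurableSpace Ω]

/-- The filter of families of events `E p` such that the (outer) probability of the complement of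
`E p` tends to zero along `l`. -/
def whp (l : Filter ι) (P : Measure Ω) : Filter (ι × Ω) where
  sets := {E | Tendsto (fun p => P {ω | (p, ω) ∉ E}) l (𝓝 0)}
  univ_sets := by simpa using tendsto_const_nhds
  sets_of_superset := fun {E F} hE hEF => by
    refine tendsto_of_tendsto_of_tendsto_of_le_of_le tendsto_const_nhds hE (fun _ => zero_le) ?_
    exact fun p => measure_mono fun ω hω h => hω (hEF h)
  inter_sets := fun {E F} hE hF => by
    have hsum : Tendsto (fun p => P {ω | (p, ω) ∉ E} + P {ω | (p, ω) ∉ F}) l (𝓝 0) := by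
      simpa using Tendsto.add hE hF
    refine tendsto_of_tendsto_of_tendsto_of_le_of_le tendsto_const_nhds hsum
      (fun _ => zero_le) fun p => ?_
    refine le_trans (measure_mono fun ω hω => ?_) (measure_union_le _ _)
    by_cases h : (p, ω) ∈ E
    · exact Or.inr fun h' => hω ⟨h, h'⟩
    · exact Or.inl h

variable {l : Filter ι} {P : Measure Ω}

theorem eventually_whp {E : ι × Ω → Prop} :
    (∀ᶠ x in whp l P, E x) ↔ Tendsto (fun p => P {ω | ¬ E (p, ω)}) l (𝓝 0) := Iff.rfl

theorem eventually_whp_of_le {E : ι × Ω → Prop}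
    (h : ∀ η : ENNReal, 0 < η → ∀ᶠ p in l, P {ω | ¬ E (p, ω)} ≤ η) : ∀ᶠ x in whp l P, E x :=
  eventually_whp.2 (ENNReal.tendsto_nhds_zero.2 h)

theorem tendsto_fst_whp : Tendsto Prod.fst (whp l P) l := by
  intro s hs
  refine eventually_whp_of_le fun η _ => ?_
  filter_upwards [hs] with p hp
  simp [hp]

theorem eventually_whp_of_ae {E : Ω → Prop} (h : ∀ᵐ ω ∂P, E ω) :
    ∀ᶠ x in whp l P, E x.2 := by
  rw [eventually_whp]
  have h0 : P {ω | ¬ E ω} = 0 := ae_iff.1 h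
  simpa [h0] using tendsto_const_nhds

/-- This lets squeezing, algebra of limits and ultrafilters act directly on convergence in
probability. Nothing need be measurable, since `P` acts as an outer measure. -/
theorem tendstoInMeasure_iff_whp {f : ι → Ω → ℝ} {g : Ω → ℝ} :
    TendstoInMeasure P f l g ↔
      Tendsto (fun x : ι × Ω => f x.1 x.2 - g x.2) (whp l P) (𝓝 0) := by
  rw [tendstoInMeasure_iff_norm, Metric.tendsto_nhds]
  refine forall₂_congr fun ε _ => ?_
  rw [eventually_whp]
  simp

/-- An event holds with high probability if it does so on each of a sequence of events that
exhaust the probability space. -/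
theorem eventually_whp_of_exhaustion {E : ι × Ω → Prop} {S : ℕ → Set Ω}
    (hS : Tendsto (fun k => P (S k)ᶜ) atTop (𝓝 0))
    (h : ∀ k, ∀ᶠ x in whp l P ⊓ 𝓟 {x | x.2 ∈ S k}, E x) : ∀ᶠ x in whp l P, E x := by
  refine eventually_whp_of_le fun η hη => ?_
  have hη2 : 0 < η / 2 := ENNReal.half_pos hη.ne'
  obtain ⟨k, hk⟩ := ((ENNReal.tendsto_nhds_zero.1 hS) _ hη2).exists
  have hE := h k
  rw [eventually_inf_principal, eventually_whp] at hE
  filter_upwards [(ENNReal.tendsto_nhds_zero.1 hE) _ hη2] with p hp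
  refine le_trans (measure_mono (t := (S k)ᶜ ∪ {ω | ¬ (ω ∈ S k → E (p, ω))}) fun ω hω => ?_) ?_
  · by_cases hs : ω ∈ S k
    · exact Or.inr fun h' => hω (h' hs)
    · exact Or.inl hs
  · refine (measure_union_le _ _).trans ((add_le_add hk hp).trans_eq (ENNReal.add_halves η))

theorem tendsto_whp_of_exhaustion {β : Type*} {f : ι × Ω → β} {lb : Filter β} {S : ℕ → Set Ω}
    (hS : Tendsto (fun k => P (S k)ᶜ) atTop (𝓝 0))
    (h : ∀ k, Tendsto f (whp l P ⊓ 𝓟 {x | x.2 ∈ S k}) lb) : Tendsto f (whp l P) lb :=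
  fun _ hs => eventually_whp_of_exhaustion hS fun k => h k hs

/-- Markov's inequality: convergence in mean implies convergence in probability. -/
theorem tendsto_whp_of_lintegral_le {f : ι → Ω → ℝ} {b : ι → ℝ}
    (hf : ∀ p, AEMeasurable (f p) P) (hf0 : ∀ p ω, 0 ≤ f p ω)
    (hb : ∀ᶠ p in l, ∫⁻ ω, ENNReal.ofReal (f p ω) ∂P ≤ ENNReal.ofReal (b p))
    (hb0 : Tendsto b l (𝓝 0)) :
    Tendsto (fun x : ι × Ω => f x.1 x.2) (whp l P) (𝓝 0) := by
  rw [Metric.tendsto_nhds]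
  intro ε hε
  rw [eventually_whp]
  have hε' : ENNReal.ofReal ε ≠ 0 := (ENNReal.ofReal_pos.2 hε).ne'
  have hlim : Tendsto (fun p => ENNReal.ofReal (b p) / ENNReal.ofReal ε) l (𝓝 0) := by
    have h1 := ENNReal.tendsto_ofReal hb0
    rw [ENNReal.ofReal_zero] at h1
    simpa using ENNReal.Tendsto.div_const h1 (Or.inr hε')
  refine tendsto_of_tendsto_of_tendsto_of_le_of_le' tendsto_const_nhds hlim
    (Eventually.of_forall fun _ => zero_le) ?_
  filter_upwards [hb] with p hp
  rw [ENNReal.le_div_iff_mul_le (Or.inl hε') (Or.inl ENNReal.ofReal_ne_top), mul_comm]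
  refine le_trans (le_trans ?_
    (mul_meas_ge_le_lintegral₀ (hf p).ennreal_ofReal (ENNReal.ofReal ε))) hp
  gcongr with ω
  intro h
  simp only [Real.dist_eq, sub_zero, not_lt, abs_of_nonneg (hf0 p ω)] at h
  exact ENNReal.ofReal_le_ofReal h

end WithHighProbability

/-! ### Sums of squares of matrix entries -/

section SumSq

variable {ι κ σ : Type*} [Fintype ι] [Fintype κ] [Fintype σ]

/-- The square of the Frobenius norm. -/
def fsq (A : Matrix ι κ ℝ) : ℝ := ∑ i, ∑ j, A i j ^ 2

theorem fsq_nonneg (A : Matrix ι κ ℝ) : 0 ≤ fsq A := by unfold fsq; positivity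

theorem fsq_transpose (A : Matrix ι κ ℝ) : fsq Aᵀ = fsq A := Finset.sum_comm

theorem fsq_add_le (A B : Matrix ι κ ℝ) : fsq (A + B) ≤ 2 * fsq A + 2 * fsq B := by
  simp only [fsq, Finset.mul_sum, ← Finset.sum_add_distrib]
  gcongr with i _ j _
  simp only [Matrix.add_apply]
  nlinarith [sq_nonneg (A i j - B i j)]

/-- Cauchy–Schwarz in every entry. The constant does not depend on the sizes, which grow with `n`
and `N`. -/
theorem fsq_mul_le (A : Matrix ι κ ℝ) (B : Matrix κ σ ℝ) : fsq (A * B) ≤ fsq A * fsq B := by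
  have h : ∀ i j, (A * B) i j ^ 2 ≤ (∑ k, A i k ^ 2) * ∑ k, B k j ^ 2 := fun i j => by
    rw [Matrix.mul_apply]
    exact Finset.sum_mul_sq_le_sq_mul_sq _ _ _
  calc fsq (A * B) ≤ ∑ i, ∑ j, (∑ k, A i k ^ 2) * ∑ k, B k j ^ 2 := by
        unfold fsq; gcongr with i _ j _; exact h i j
    _ = fsq A * fsq B := by
        unfold fsq
        rw [Finset.sum_comm (s := Finset.univ (α := κ)), Finset.sum_mul_sum]

theorem mulVec_dotProduct_self_le (A : Matrix ι κ ℝ) (x : κ → ℝ) :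
    A *ᵥ x ⬝ᵥ A *ᵥ x ≤ fsq A * (x ⬝ᵥ x) := by
  simp only [dotProduct, fsq, Finset.sum_mul, ← sq]
  gcongr with i _
  rw [← Finset.sum_mul]
  exact Finset.sum_mul_sq_le_sq_mul_sq Finset.univ (A i) x

theorem dotProduct_self_nonneg' (x : ι → ℝ) : 0 ≤ x ⬝ᵥ x :=
  Finset.sum_nonneg fun _ _ => mul_self_nonneg _

theorem dotProduct_sq_le (x y : ι → ℝ) : (x ⬝ᵥ y) ^ 2 ≤ (x ⬝ᵥ x) * (y ⬝ᵥ y) := by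
  simp only [dotProduct, ← sq]
  exact Finset.sum_mul_sq_le_sq_mul_sq _ _ _

theorem abs_dotProduct_le (x y : ι → ℝ) : |x ⬝ᵥ y| ≤ √(x ⬝ᵥ x) * √(y ⬝ᵥ y) := by
  rw [← Real.sqrt_mul (dotProduct_self_nonneg' x)]
  exact Real.abs_le_sqrt (dotProduct_sq_le x y)

/-- A bilinear form is bounded by the Frobenius norm. -/
theorem abs_dotProduct_mulVec_le (A : Matrix ι κ ℝ) (x : ι → ℝ) (y : κ → ℝ) :
    |x ⬝ᵥ A *ᵥ y| ≤ √(fsq A) * (√(x ⬝ᵥ x) * √(y ⬝ᵥ y)) := by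
  refine (abs_dotProduct_le _ _).trans ?_
  have h := Real.sqrt_le_sqrt (mulVec_dotProduct_self_le A y)
  rw [Real.sqrt_mul (fsq_nonneg A)] at h
  calc _ ≤ √(x ⬝ᵥ x) * (√(fsq A) * √(y ⬝ᵥ y)) := by gcongr
    _ = _ := by ring

theorem abs_quadratic_le (A : Matrix ι ι ℝ) (x : ι → ℝ) :
    |x ⬝ᵥ A *ᵥ x| ≤ √(fsq A) * (x ⬝ᵥ x) := by
  refine (abs_dotProduct_mulVec_le A x x).trans_eq ?_
  rw [Real.mul_self_sqrt (dotProduct_self_nonneg' x)]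

theorem tendsto_fsq_zero {X : Type*} {F : Filter X} {A : X → Matrix ι κ ℝ}
    (h : ∀ i j, Tendsto (fun x => A x i j) F (𝓝 0)) : Tendsto (fun x => fsq (A x)) F (𝓝 0) := by
  have : Tendsto (fun x => fsq (A x)) F (𝓝 (∑ _i : ι, ∑ _j : κ, (0 : ℝ) ^ 2)) :=
    tendsto_finsetSum _ fun i _ => tendsto_finsetSum _ fun j _ => (h i j).pow 2
  simpa using this

end SumSq

/-! ### Ordered eigensystems -/

section Eigensystem

/-- Fewer linear conditions than dimensions have a nontrivial common solution. -/
theorem exists_ne_zero_orthogonal {κ : Type*} [Fintype κ] {k : ℕ} (h : Fintype.card κ < k)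
    (u : κ → Fin k → ℝ) : ∃ x : Fin k → ℝ, x ≠ 0 ∧ ∀ i, u i ⬝ᵥ x = 0 := by
  have hker : LinearMap.ker (Matrix.mulVecLin (Matrix.of u)) ≠ ⊥ :=
    LinearMap.ker_ne_bot_of_finrank_lt (by simpa using h)
  obtain ⟨x, hx, hx0⟩ := (Submodule.ne_bot_iff _).1 hker
  refine ⟨x, hx0, fun i => ?_⟩
  have := congrFun (LinearMap.mem_ker.1 hx) i
  simpa [Matrix.mulVec] using this

namespace IsOrderedEigensystem

variable {k : ℕ} {A : Matrix (Fin k) (Fin k) ℝ} {c c' : Fin k → ℝ} {v v' : Fin k → Fin k → ℝ}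

theorem of_mul_transpose (h : IsOrderedEigensystem A c v) :
    Matrix.of v * (Matrix.of v)ᵀ = 1 := by
  ext i j
  simpa [Matrix.mul_apply, dotProduct, Matrix.one_apply] using h.orthonormal i j

theorem transpose_mul_of (h : IsOrderedEigensystem A c v) :
    (Matrix.of v)ᵀ * Matrix.of v = 1 := mul_eq_one_comm.1 h.of_mul_transpose

/-- Parseval's identity. -/
theorem dotProduct_eq (h : IsOrderedEigensystem A c v) (x z : Fin k → ℝ) :
    x ⬝ᵥ z = ∑ j, (v j ⬝ᵥ x) * (v j ⬝ᵥ z) := by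
  have h1 : (Matrix.of v *ᵥ x) ⬝ᵥ (Matrix.of v *ᵥ z) = x ⬝ᵥ z := by
    rw [Matrix.dotProduct_mulVec, Matrix.vecMul_mulVec, h.transpose_mul_of, Matrix.vecMul_one]
  rw [← h1]
  rfl

theorem expansion (h : IsOrderedEigensystem A c v) (x : Fin k → ℝ) :
    x = ∑ j, (v j ⬝ᵥ x) • v j := by
  ext i
  have := h.dotProduct_eq (Pi.single i 1) x
  simp only [single_dotProduct, one_mul, dotProduct_single, mul_one] at this
  rw [this, Finset.sum_apply]
  exact Finset.sum_congr rfl fun j _ => by simp [mul_comm]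

theorem dotProduct_mulVec (h : IsOrderedEigensystem A c v) (j : Fin k) (x : Fin k → ℝ) :
    v j ⬝ᵥ A *ᵥ x = c j * (v j ⬝ᵥ x) := by
  conv_lhs => rw [h.expansion x, Matrix.mulVec_sum, dotProduct_sum]
  simp [Matrix.mulVec_smul, h.eigen, h.orthonormal, mul_comm]

theorem quadratic_eq (h : IsOrderedEigensystem A c v) (x : Fin k → ℝ) :
    x ⬝ᵥ A *ᵥ x = ∑ j, c j * (v j ⬝ᵥ x) ^ 2 := by
  rw [h.dotProduct_eq]
  exact Finset.sum_congr rfl fun j _ => by rw [h.dotProduct_mulVec]; ring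

theorem quadratic_le (h : IsOrderedEigensystem A c v) (j : Fin k) (x : Fin k → ℝ)
    (hx : ∀ i < j, v i ⬝ᵥ x = 0) : x ⬝ᵥ A *ᵥ x ≤ c j * (x ⬝ᵥ x) := by
  rw [h.quadratic_eq, h.dotProduct_eq, Finset.mul_sum]
  refine Finset.sum_le_sum fun i _ => ?_
  rcases lt_or_ge i j with hij | hij
  · simp [hx i hij]
  · rw [← sq]
    exact mul_le_mul_of_nonneg_right (h.antitone hij) (sq_nonneg _)

theorem le_quadratic (h : IsOrderedEigensystem A c v) (j : Fin k) (x : Fin k → ℝ)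
    (hx : ∀ i, j < i → v i ⬝ᵥ x = 0) : c j * (x ⬝ᵥ x) ≤ x ⬝ᵥ A *ᵥ x := by
  rw [h.quadratic_eq, h.dotProduct_eq, Finset.mul_sum]
  refine Finset.sum_le_sum fun i _ => ?_
  rcases lt_or_ge j i with hij | hij
  · simp [hx i hij]
  · rw [← sq]
    exact mul_le_mul_of_nonneg_right (h.antitone hij) (sq_nonneg _)

/-- Courant–Fischer: a vector orthogonal to `v' i` for `i < j` and to `v i` for `i > j` satisfies
only `k - 1` conditions, and its Rayleigh quotient lies between `c j` and `c' j`. -/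
theorem eigenvalue_le (h : IsOrderedEigensystem A c v) (h' : IsOrderedEigensystem A c' v')
    (j : Fin k) : c j ≤ c' j := by
  obtain ⟨x, hx0, hx⟩ := exists_ne_zero_orthogonal (κ := {i : Fin k // i ≠ j}) (k := k)
    (by rw [Fintype.card_subtype_compl]; simp; exact j.pos)
    (fun i => if i.1 < j then v' i else v i)
  have hpos : 0 < x ⬝ᵥ x := (dotProduct_self_nonneg' x).lt_of_ne' (by simpa using hx0)
  have h1 := h.le_quadratic j x fun i hi => by
    simpa [hi.not_gt] using hx ⟨i, hi.ne'⟩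
  have h2 := h'.quadratic_le j x fun i hi => by
    simpa [hi] using hx ⟨i, hi.ne⟩
  exact le_of_mul_le_mul_right (h1.trans h2) hpos

/-- The ordered eigenvalues are determined by the matrix. -/
theorem eigenvalue_unique (h : IsOrderedEigensystem A c v) (h' : IsOrderedEigensystem A c' v') :
    c = c' :=
  funext fun j => le_antisymm (h.eigenvalue_le h' j) (h'.eigenvalue_le h j)

theorem eq_mul_diagonal_mul (h : IsOrderedEigensystem A c v) :
    A = (Matrix.of v)ᵀ * Matrix.diagonal c * Matrix.of v := by
  have h1 : A * (Matrix.of v)ᵀ = (Matrix.of v)ᵀ * Matrix.diagonal c := by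
    ext i j
    rw [Matrix.mul_diagonal]
    have := congrFun (h.eigen j) i
    simp only [Matrix.mulVec, dotProduct, Pi.smul_apply, smul_eq_mul] at this
    simpa [Matrix.mul_apply, mul_comm] using this
  rw [← h1, Matrix.mul_assoc, h.transpose_mul_of, Matrix.mul_one]

/-- An eigenvector for any other value would be orthogonal to the whole basis. This is what converts
the count of distinct eigenvalues in Q1 into injectivity of the list `c`. -/
theorem spectrum_subset (h : IsOrderedEigensystem A c v) : spectrum ℝ A ⊆ range c := by
  intro r hr
  rw [← Matrix.spectrum_toLin', ← Module.End.hasEigenvalue_iff_mem_spectrum] at hr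
  obtain ⟨x, hx⟩ := hr.exists_hasEigenvector
  have hAx : A *ᵥ x = r • x := by simpa using hx.apply_eq_smul
  by_contra hne
  refine hx.2 ?_
  rw [h.expansion x]
  refine Finset.sum_eq_zero fun j _ => ?_
  have h1 := h.dotProduct_mulVec j x
  rw [hAx, dotProduct_smul, smul_eq_mul] at h1
  have h2 : (r - c j) * (v j ⬝ᵥ x) = 0 := by linarith
  rcases mul_eq_zero.1 h2 with h3 | h3
  · exact absurd ⟨j, (sub_eq_zero.1 h3).symm⟩ hne
  · simp [h3]

end IsOrderedEigensystem

end Eigensystem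

/-! ### Eigenvectors of a perturbed low rank matrix -/

section LowRank

variable {k d : ℕ} {M : Matrix (Fin k) (Fin k) ℝ} {μ : Fin k → ℝ} {y : Fin k → Fin k → ℝ}

/-- Orthogonality to the later `y i` and to the `d` columns of `Z` makes `k - 1 - j + d < k`
conditions. On a common solution the form of `M` is at least `μ j` and coincides with that of `E`.
-/
theorem IsOrderedEigensystem.eigenvalue_le_of_ker (h : IsOrderedEigensystem M μ y)
    (Z : Matrix (Fin k) (Fin d) ℝ) (E : Matrix (Fin k) (Fin k) ℝ)
    (hE : ∀ x, Zᵀ *ᵥ x = 0 → x ⬝ᵥ M *ᵥ x = x ⬝ᵥ E *ᵥ x) (j : Fin k) (hj : d ≤ j) :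
    μ j ≤ √(fsq E) := by
  obtain ⟨x, hx0, hx⟩ := exists_ne_zero_orthogonal (κ := {i : Fin k // j < i} ⊕ Fin d) (k := k)
    (by
      have hlt : Fintype.card {i : Fin k // j < i} = k - 1 - j := by
        rw [Fintype.card_subtype, ← Fin.card_Ioi j]
        exact congrArg Finset.card (by ext; simp)
      rw [Fintype.card_sum, hlt, Fintype.card_fin]
      have := j.2
      omega)
    (Sum.elim (fun i => y i) (fun l => Zᵀ l))
  have hpos : 0 < x ⬝ᵥ x := (dotProduct_self_nonneg' x).lt_of_ne' (by simpa using hx0)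
  have h1 := h.le_quadratic j x fun i hi => by simpa using hx (Sum.inl ⟨i, hi⟩)
  have h2 : Zᵀ *ᵥ x = 0 := funext fun l => hx (Sum.inr l)
  rw [hE x h2] at h1
  exact le_of_mul_le_mul_right (h1.trans ((le_abs_self _).trans (abs_quadratic_le E x))) hpos

/-- Both terms are bilinear forms at the unit vectors `y i`, `y j`: one of `A * Aᵀ`, the other of
`M`. -/
theorem IsOrderedEigensystem.gram_low_rank (h : IsOrderedEigensystem M μ y)
    (A : Matrix (Fin k) (Fin d) ℝ) (i j : Fin k) :
    |(Aᵀ *ᵥ y i) ⬝ᵥ (Aᵀ *ᵥ y j) - if i = j then μ j else 0| ≤ √(fsq (M - A * Aᵀ)) := by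
  have h1 : (Aᵀ *ᵥ y i) ⬝ᵥ (Aᵀ *ᵥ y j) = y i ⬝ᵥ (A * Aᵀ) *ᵥ y j := by
    rw [Matrix.dotProduct_mulVec, Matrix.vecMul_mulVec, Matrix.transpose_transpose,
      ← Matrix.dotProduct_mulVec, ← Matrix.mulVec_mulVec, Matrix.mulVec_mulVec]
  have h2 : (if i = j then μ j else 0) = y i ⬝ᵥ M *ᵥ y j := by
    rw [h.eigen, dotProduct_smul, h.orthonormal]; simp
  rw [h1, h2, abs_sub_comm, ← dotProduct_sub, ← Matrix.sub_mulVec]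
  refine (abs_dotProduct_mulVec_le _ _ _).trans_eq ?_
  rw [h.orthonormal, h.orthonormal]
  simp

/-- Applying `Aᵀ` to `M y_j = μ_j y_j` shows that the defect is `-Aᵀ (M - A Aᵀ) y_j`. -/
theorem IsOrderedEigensystem.residual_low_rank (h : IsOrderedEigensystem M μ y)
    (A : Matrix (Fin k) (Fin d) ℝ) (j : Fin k) :
    ((Aᵀ * A) *ᵥ (Aᵀ *ᵥ y j) - μ j • (Aᵀ *ᵥ y j)) ⬝ᵥ
      ((Aᵀ * A) *ᵥ (Aᵀ *ᵥ y j) - μ j • (Aᵀ *ᵥ y j)) ≤ fsq A * fsq (M - A * Aᵀ) := by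
  have h1 : (Aᵀ * A) *ᵥ (Aᵀ *ᵥ y j) - μ j • (Aᵀ *ᵥ y j) = -((Aᵀ * (M - A * Aᵀ)) *ᵥ y j) := by
    rw [← Matrix.mulVec_smul, ← h.eigen j, Matrix.mulVec_mulVec, Matrix.mulVec_mulVec,
      ← Matrix.sub_mulVec, ← Matrix.neg_mulVec, Matrix.mul_sub, neg_sub, Matrix.mul_assoc]
  rw [h1, neg_dotProduct_neg]
  refine (mulVec_dotProduct_self_le _ _).trans ?_
  rw [h.orthonormal, if_pos rfl, mul_one, ← fsq_transpose A]
  exact fsq_mul_le _ _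

/-- The test vector is `x = A a`, with `a ∈ ℝ^d` subject to the `j < d` conditions that make `x`
orthogonal to the earlier `y i`. -/
theorem IsOrderedEigensystem.le_eigenvalue_low_rank (h : IsOrderedEigensystem M μ y)
    (A : Matrix (Fin k) (Fin d) ℝ) (H : Matrix (Fin d) (Fin d) ℝ) {β : ℝ}
    (hβ : ∀ a, β * (a ⬝ᵥ a) ≤ a ⬝ᵥ H *ᵥ a) (hlt : √(fsq (Aᵀ * A - H)) < β)
    (j : Fin k) (hj : (j : ℕ) < d) :
    β - √(fsq (Aᵀ * A - H)) - √(fsq (M - A * Aᵀ)) ≤ μ j := by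
  obtain ⟨a, ha0, ha⟩ := exists_ne_zero_orthogonal (κ := {i : Fin k // i < j}) (k := d)
    (by
      rw [Fintype.card_subtype]
      have : (Finset.univ.filter fun i : Fin k => i < j).card = j := by
        rw [← Fin.card_Iio j]
        exact congrArg Finset.card (by ext; simp)
      omega)
    (fun i => Aᵀ *ᵥ y i)
  have hapos : 0 < a ⬝ᵥ a := (dotProduct_self_nonneg' a).lt_of_ne' (by simpa using ha0)
  set η := √(fsq (Aᵀ * A - H))
  set x := A *ᵥ a with hx
  have hxx : x ⬝ᵥ x = a ⬝ᵥ (Aᵀ * A) *ᵥ a := by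
    rw [hx, Matrix.dotProduct_mulVec, Matrix.vecMul_mulVec, ← Matrix.dotProduct_mulVec]
  have hx1 : (β - η) * (a ⬝ᵥ a) ≤ x ⬝ᵥ x := by
    have h1 := neg_le_of_abs_le (abs_quadratic_le (Aᵀ * A - H) a)
    rw [Matrix.sub_mulVec, dotProduct_sub, ← hxx] at h1
    linarith [hβ a]
  have hxpos : 0 < x ⬝ᵥ x := lt_of_lt_of_le (mul_pos (sub_pos.2 hlt) hapos) hx1
  have hyx : ∀ i < j, y i ⬝ᵥ x = 0 := fun i hi => by
    have := ha ⟨i, hi⟩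
    rwa [Matrix.mulVec_transpose, ← Matrix.dotProduct_mulVec] at this
  have h2 := h.quadratic_le j x hyx
  have h3 : x ⬝ᵥ M *ᵥ x = (Aᵀ *ᵥ x) ⬝ᵥ (Aᵀ *ᵥ x) + x ⬝ᵥ (M - A * Aᵀ) *ᵥ x := by
    have : (Aᵀ *ᵥ x) ⬝ᵥ (Aᵀ *ᵥ x) = x ⬝ᵥ (A * Aᵀ) *ᵥ x := by
      rw [Matrix.dotProduct_mulVec, Matrix.vecMul_mulVec, Matrix.transpose_transpose,
        ← Matrix.dotProduct_mulVec, ← Matrix.mulVec_mulVec, Matrix.mulVec_mulVec]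
    rw [this, ← dotProduct_add, ← Matrix.add_mulVec, add_sub_cancel]
  have h4 := neg_le_of_abs_le (abs_quadratic_le (M - A * Aᵀ) x)
  -- Cauchy–Schwarz for `x ⬝ᵥ x = a ⬝ᵥ Aᵀ x`. With `hx1` it transfers the lower bound of `Aᵀ A` to
  -- `A Aᵀ` on the range of `A`.
  have h5 : (x ⬝ᵥ x) ^ 2 ≤ (a ⬝ᵥ a) * ((Aᵀ *ᵥ x) ⬝ᵥ (Aᵀ *ᵥ x)) := by
    rw [hxx]
    refine (dotProduct_sq_le _ _).trans_eq ?_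
    rw [hx, Matrix.mulVec_mulVec]
  have h6 : (β - η) * (x ⬝ᵥ x) ≤ (Aᵀ *ᵥ x) ⬝ᵥ (Aᵀ *ᵥ x) := by
    refine le_of_mul_le_mul_right ?_ hxpos
    calc (β - η) * (x ⬝ᵥ x) * (x ⬝ᵥ x) = (β - η) * (x ⬝ᵥ x) ^ 2 := by ring
      _ ≤ (β - η) * ((a ⬝ᵥ a) * ((Aᵀ *ᵥ x) ⬝ᵥ (Aᵀ *ᵥ x))) :=
          mul_le_mul_of_nonneg_left h5 (sub_pos.2 hlt).le
      _ = ((β - η) * (a ⬝ᵥ a)) * ((Aᵀ *ᵥ x) ⬝ᵥ (Aᵀ *ᵥ x)) := by ring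
      _ ≤ (x ⬝ᵥ x) * ((Aᵀ *ᵥ x) ⬝ᵥ (Aᵀ *ᵥ x)) :=
          mul_le_mul_of_nonneg_right hx1 (dotProduct_self_nonneg' _)
      _ = _ := mul_comm _ _
  refine le_of_mul_le_mul_right ?_ hxpos
  linarith

end LowRank

/-! ### Convergence of eigenvectors with simple eigenvalues -/

section EigenvectorLimit

variable {d : ℕ}

/-- The exact case of the perturbation argument. The expression is `‖±w j - √(c j) φ j‖²` with the
sign that makes the angle acute. Normalizing the `w j` yields a second ordered eigensystem of `H`,
so `μ = c`, and simplicity of the eigenvalues makes `w j` a multiple of `φ j`. -/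
theorem sq_add_sub_two_mul_eq_zero {c μ : Fin d → ℝ} {φ w : Fin d → Fin d → ℝ}
    {H : Matrix (Fin d) (Fin d) ℝ} (hH : IsOrderedEigensystem H c φ)
    (hc : StrictAnti c) (hμ : Antitone μ) (hμ0 : ∀ j, 0 < μ j)
    (hw : ∀ i j, w i ⬝ᵥ w j = if i = j then μ j else 0) (hHw : ∀ j, H *ᵥ w j = μ j • w j)
    (j : Fin d) : w j ⬝ᵥ w j + c j - 2 * (√(c j) * |φ j ⬝ᵥ w j|) = 0 := by
  have hsys : IsOrderedEigensystem H μ fun j => (√(μ j))⁻¹ • w j := by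
    refine ⟨hμ, fun i j => ?_, fun j => ?_⟩
    · rw [smul_dotProduct, dotProduct_smul, hw]
      by_cases hij : i = j
      · subst hij
        have := Real.mul_self_sqrt (hμ0 i).le
        have h0 := (Real.sqrt_pos.2 (hμ0 i)).ne'
        simp only [if_true, smul_eq_mul]
        field_simp
        nlinarith
      · simp [hij]
    · rw [Matrix.mulVec_smul, hHw, smul_comm]
  have hcμ : c = μ := hH.eigenvalue_unique hsys
  have horth : ∀ i, i ≠ j → φ i ⬝ᵥ w j = 0 := fun i hij => by
    have h1 := hH.dotProduct_mulVec i (w j)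
    rw [hHw, dotProduct_smul, smul_eq_mul, ← hcμ] at h1
    have h2 : (c j - c i) * (φ i ⬝ᵥ w j) = 0 := by linarith
    exact (mul_eq_zero.1 h2).resolve_left (sub_ne_zero.2 fun h => hij (hc.injective h).symm)
  have hpars : w j ⬝ᵥ w j = (φ j ⬝ᵥ w j) ^ 2 := by
    rw [hH.dotProduct_eq, Finset.sum_eq_single j (fun i _ hi => by simp [horth i hi]) (by simp), sq]
  have hwc : w j ⬝ᵥ w j = c j := by rw [hw, if_pos rfl, hcμ]
  have habs : |φ j ⬝ᵥ w j| = √(c j) := by rw [← hwc, hpars, Real.sqrt_sq_eq_abs]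
  have hcj : 0 ≤ c j := hcμ ▸ (hμ0 j).le
  rw [hwc, habs, Real.mul_self_sqrt hcj]
  ring

/-- Eigensystems with eigenvalues in `[κ, K]` that are separated by at least `κ`. -/
structure IsSeparated (κ K : ℝ) (c : Fin d → ℝ) (φ : Fin d → Fin d → ℝ) : Prop where
  lower : ∀ j, κ ≤ c j
  upper : ∀ j, c j ≤ K
  gap : ∀ i j, i < j → c j + κ ≤ c i
  orthonormal : ∀ i j, φ i ⬝ᵥ φ j = if i = j then 1 else 0

theorem IsSeparated.abs_le_one {κ K : ℝ} {c : Fin d → ℝ} {φ : Fin d → Fin d → ℝ}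
    (h : IsSeparated κ K c φ) (j i : Fin d) : |φ j i| ≤ 1 := by
  have h1 := h.orthonormal j j
  rw [if_pos rfl] at h1
  have h2 : φ j i * φ j i ≤ φ j ⬝ᵥ φ j :=
    Finset.single_le_sum (f := fun i => φ j i * φ j i) (fun i _ => mul_self_nonneg _)
      (Finset.mem_univ i)
  exact abs_le_one_iff_mul_self_le_one.2 (h2.trans h1.le)

theorem IsSeparated.isOrderedEigensystem {d : ℕ} {κ K : ℝ} {c : Fin d → ℝ}
    {φ : Fin d → Fin d → ℝ} (h : IsSeparated κ K c φ) (hκ : 0 ≤ κ) :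
    IsOrderedEigensystem ((Matrix.of φ)ᵀ * Matrix.diagonal c * Matrix.of φ) c φ := by
  refine ⟨fun i j hij => ?_, h.orthonormal, fun j => ?_⟩
  · rcases hij.eq_or_lt with rfl | hij
    · exact le_rfl
    · linarith [h.gap i j hij]
  · ext i
    have h1 : (Matrix.of φ) *ᵥ φ j = Pi.single j 1 := by
      ext l
      simpa [Matrix.mulVec, Pi.single_apply] using h.orthonormal l j
    rw [← Matrix.mulVec_mulVec, h1]
    simp [Matrix.mul_diagonal, mul_comm]

theorem isClosed_isSeparated (κ K : ℝ) :
    IsClosed {p : (Fin d → ℝ) × (Fin d → Fin d → ℝ) | IsSeparated κ K p.1 p.2} := by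
  have : {p : (Fin d → ℝ) × (Fin d → Fin d → ℝ) | IsSeparated κ K p.1 p.2} =
      (⋂ j, {p | κ ≤ p.1 j}) ∩ (⋂ j, {p | p.1 j ≤ K}) ∩
      (⋂ i, ⋂ j, ⋂ _ : i < j, {p | p.1 j + κ ≤ p.1 i}) ∩
      (⋂ i, ⋂ j, {p | p.2 i ⬝ᵥ p.2 j = if i = j then 1 else 0}) := by
    ext p
    simp only [mem_inter_iff, mem_iInter, mem_ofPred_eq]
    exact ⟨fun h => ⟨⟨⟨h.1, h.2⟩, h.3⟩, h.4⟩, fun h => ⟨h.1.1.1, h.1.1.2, h.1.2, h.2⟩⟩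
  rw [this]
  refine ((IsClosed.inter ?_ ?_).inter ?_).inter ?_
  · exact isClosed_iInter fun j => isClosed_le continuous_const (by fun_prop)
  · exact isClosed_iInter fun j => isClosed_le (by fun_prop) continuous_const
  · exact isClosed_iInter fun i => isClosed_iInter fun j => isClosed_iInter fun _ =>
      isClosed_le (by fun_prop) (by fun_prop)
  · exact isClosed_iInter fun i => isClosed_iInter fun j =>
      isClosed_eq (by unfold dotProduct; fun_prop) continuous_const

theorem norm_le_of_entries {K : ℝ} (hK : 0 ≤ K) {φ : Fin d → Fin d → ℝ}
    (h : ∀ j i, |φ j i| ≤ K) : ‖φ‖ ≤ K :=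
  (pi_norm_le_iff_of_nonneg hK).2 fun j => (pi_norm_le_iff_of_nonneg hK).2 fun i => h j i

/-- A fixed gap `κ`, unlike mere distinctness, survives limits; this is why the eigenvalues are
required to be separated quantitatively. -/
theorem isCompact_isSeparated {κ K : ℝ} (hκ : 0 ≤ κ) :
    IsCompact {p : (Fin d → ℝ) × (Fin d → Fin d → ℝ) | IsSeparated κ K p.1 p.2} := by
  refine Metric.isCompact_of_isClosed_isBounded (isClosed_isSeparated κ K)
    ((Metric.isBounded_closedBall (x := 0) (r := max |K| 1)).subset fun p hp => ?_)
  have hp' : IsSeparated κ K p.1 p.2 := hp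
  have h0 : 0 ≤ max |K| 1 := le_max_of_le_right zero_le_one
  rw [mem_closedBall_zero_iff, Prod.norm_def]
  refine max_le ((pi_norm_le_iff_of_nonneg h0).2 fun j => ?_)
    (norm_le_of_entries h0 fun j i => (hp'.abs_le_one j i).trans (le_max_right _ _))
  refine le_max_of_le_left ?_
  rw [Real.norm_eq_abs, abs_of_nonneg (hκ.trans (hp'.lower j))]
  exact (hp'.upper j).trans (le_abs_self K)

/-- Along an ultrafilter finer than `F` the bounded data `(c, φ, μ, w)` converge. The approximate
relations become exact in the limit, the gaps persist, and `sq_add_sub_two_mul_eq_zero` applies.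
Although `H`, `c` and `φ` vary with `x`, no rate is needed. -/
theorem tendsto_eigenvectors {X : Type*} {F : Filter X} {κ K κ' K' : ℝ} (hκ : 0 < κ)
    (hκ' : 0 < κ') {c μ : X → Fin d → ℝ} {φ w : X → Fin d → Fin d → ℝ}
    {H : X → Matrix (Fin d) (Fin d) ℝ}
    (hsep : ∀ᶠ x in F, IsSeparated κ K (c x) (φ x))
    (hH : ∀ᶠ x in F, IsOrderedEigensystem (H x) (c x) (φ x))
    (hμ : ∀ᶠ x in F, Antitone (μ x)) (hμl : ∀ᶠ x in F, ∀ j, κ' ≤ μ x j)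
    (hμu : ∀ᶠ x in F, ∀ j, μ x j ≤ K')
    (hw : ∀ i j, Tendsto (fun x => w x i ⬝ᵥ w x j - if i = j then μ x j else 0) F (𝓝 0))
    (hHw : ∀ j, Tendsto (fun x => H x *ᵥ w x j - μ x j • w x j) F (𝓝 0)) (j : Fin d) :
    Tendsto (fun x => w x j ⬝ᵥ w x j + c x j - 2 * (√(c x j) * |φ x j ⬝ᵥ w x j|)) F (𝓝 0) := by
  have hwb : ∀ᶠ x in F, ∀ i j, |w x i j| ≤ K' + 2 := by
    have h1 : ∀ᶠ x in F, ∀ i, w x i ⬝ᵥ w x i - μ x i ≤ 1 := by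
      rw [eventually_all]
      intro i
      have := (hw i i).eventually_le_const zero_lt_one
      simpa using this
    filter_upwards [h1, hμu, hμl] with x h1 h2 h3 i l
    have h4 : w x i l * w x i l ≤ w x i ⬝ᵥ w x i :=
      Finset.single_le_sum (f := fun l => w x i l * w x i l) (fun l _ => mul_self_nonneg _)
        (Finset.mem_univ l)
    have h5 := h1 i
    have h6 := h2 i
    have h7 := h3 i
    -- The square is at most `K' + 1`, and `K' ≥ κ' > 0`, so `(K' + 2) ^ 2` dominates it.
    refine abs_le_of_sq_le_sq ?_ (by linarith)
    nlinarith
  rw [tendsto_iff_ultrafilter]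
  intro U hU
  let g : X → ((Fin d → ℝ) × (Fin d → Fin d → ℝ)) × (Fin d → ℝ) × (Fin d → Fin d → ℝ) :=
    fun x => ((c x, φ x), (μ x, w x))
  have hg : ∀ᶠ x in (U : Filter X), g x ∈ {p | IsSeparated κ K p.1 p.2} ×ˢ
      Metric.closedBall (0 : (Fin d → ℝ) × (Fin d → Fin d → ℝ)) (|K'| + 2) := by
    filter_upwards [hU hsep, hU hwb, hU hμl, hU hμu] with x h1 h2 h3 h4
    refine ⟨h1, ?_⟩
    have h0 : 0 ≤ |K'| + 2 := by positivity
    rw [mem_closedBall_zero_iff, Prod.norm_def]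
    refine max_le ((pi_norm_le_iff_of_nonneg h0).2 fun j => ?_)
      (norm_le_of_entries h0 fun j i => (h2 j i).trans (by gcongr; exact le_abs_self _))
    rw [Real.norm_eq_abs, abs_of_nonneg (hκ'.le.trans (h3 j))]
    linarith [h4 j, le_abs_self K']
  obtain ⟨p, hp, hlim⟩ := ((isCompact_isSeparated hκ.le).prod
    (isCompact_closedBall _ _)).ultrafilter_le_nhds (U.map g) (le_principal_iff.2 hg)
  replace hlim : Tendsto g U (𝓝 p) := hlim
  obtain ⟨⟨c₀, φ₀⟩, μ₀, w₀⟩ := p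
  have hsep₀ : IsSeparated κ K c₀ φ₀ := hp.1
  have hc : Tendsto c U (𝓝 c₀) := (continuous_fst.comp continuous_fst).tendsto _ |>.comp hlim
  have hφ : Tendsto φ U (𝓝 φ₀) := (continuous_snd.comp continuous_fst).tendsto _ |>.comp hlim
  have hμ₀ : Tendsto μ U (𝓝 μ₀) := (continuous_fst.comp continuous_snd).tendsto _ |>.comp hlim
  have hw₀ : Tendsto w U (𝓝 w₀) := (continuous_snd.comp continuous_snd).tendsto _ |>.comp hlim
  have hc' := fun j => tendsto_pi_nhds.1 hc j
  have hφ' := fun j i => tendsto_pi_nhds.1 (tendsto_pi_nhds.1 hφ j) i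
  have hμ' := fun j => tendsto_pi_nhds.1 hμ₀ j
  have hw' := fun j i => tendsto_pi_nhds.1 (tendsto_pi_nhds.1 hw₀ j) i
  have hdot : ∀ i j, Tendsto (fun x => w x i ⬝ᵥ w x j) U (𝓝 (w₀ i ⬝ᵥ w₀ j)) := fun i j =>
    tendsto_finsetSum _ fun l _ => (hw' i l).mul (hw' j l)
  have hdotφ : ∀ j, Tendsto (fun x => φ x j ⬝ᵥ w x j) U (𝓝 (φ₀ j ⬝ᵥ w₀ j)) := fun j =>
    tendsto_finsetSum _ fun l _ => (hφ' j l).mul (hw' j l)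
  have hanti : StrictAnti c₀ := fun i j hij => by linarith [hsep₀.gap i j hij]
  set H₀ := (Matrix.of φ₀)ᵀ * Matrix.diagonal c₀ * Matrix.of φ₀ with hH₀
  -- `H` is recovered from `c` and `φ` by the spectral decomposition, so its convergence needs no
  -- further compactness.
  have hHl : ∀ i j, Tendsto (fun x => H x i j) U (𝓝 (H₀ i j)) := fun i j => by
    have h1 : Tendsto (fun x => ∑ l, φ x l i * c x l * φ x l j) U
        (𝓝 (∑ l, φ₀ l i * c₀ l * φ₀ l j)) :=
      tendsto_finsetSum _ fun l _ => ((hφ' l i).mul (hc' l)).mul (hφ' l j)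
    have h2 : H₀ i j = ∑ l, φ₀ l i * c₀ l * φ₀ l j := by
      rw [hH₀, Matrix.mul_apply]
      simp [Matrix.mul_diagonal]
    rw [h2]
    refine h1.congr' ?_
    filter_upwards [hU hH] with x hx
    rw [hx.eq_mul_diagonal_mul, Matrix.mul_apply]
    simp [Matrix.mul_diagonal]
  have hsys : IsOrderedEigensystem H₀ c₀ φ₀ := hsep₀.isOrderedEigensystem hκ.le
  have hgram : ∀ i j, w₀ i ⬝ᵥ w₀ j = if i = j then μ₀ j else 0 := fun i j => by
    have h1 : Tendsto (fun x => w x i ⬝ᵥ w x j - if i = j then μ x j else 0) U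
        (𝓝 (w₀ i ⬝ᵥ w₀ j - if i = j then μ₀ j else 0)) := by
      refine (hdot i j).sub ?_
      split_ifs
      · exact hμ' j
      · exact tendsto_const_nhds
    exact sub_eq_zero.1 (tendsto_nhds_unique h1 ((hw i j).mono_left hU))
  have heig : ∀ j, H₀ *ᵥ w₀ j = μ₀ j • w₀ j := fun j => by
    ext i
    have h1 : Tendsto (fun x => (H x *ᵥ w x j - μ x j • w x j) i) U
        (𝓝 ((H₀ *ᵥ w₀ j - μ₀ j • w₀ j) i)) := by
      have h3 : Tendsto (fun x => (H x *ᵥ w x j) i) U (𝓝 ((H₀ *ᵥ w₀ j) i)) := by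
        simp only [Matrix.mulVec, dotProduct]
        exact tendsto_finsetSum _ fun l _ => (hHl i l).mul (hw' j l)
      exact h3.sub ((hμ' j).mul (hw' j i))
    have h2 := tendsto_nhds_unique h1 ((tendsto_pi_nhds.1 (hHw j) i).mono_left hU)
    exact sub_eq_zero.1 h2
  have hμanti : Antitone μ₀ := fun i j hij =>
    le_of_tendsto_of_tendsto (hμ' j) (hμ' i) (by filter_upwards [hU hμ] with x hx using hx hij)
  have hμpos : ∀ j, 0 < μ₀ j := fun j =>
    hκ'.trans_le (ge_of_tendsto (hμ' j) (by filter_upwards [hU hμl] with x hx using hx j))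
  rw [← sq_add_sub_two_mul_eq_zero hsys hanti hμanti hμpos hgram heig j]
  exact ((hdot j j).add (hc' j)).sub
    (((hc' j).sqrt.mul (hdotφ j).abs).const_mul 2)

end EigenvectorLimit

/-! ### Sampling grids -/

namespace UniformGrid

variable {lo hi : ℝ} (g : UniformGrid lo hi)

theorem num_mul_mesh_le (n : ℕ) : (g.num n : ℝ) * g.mesh n ≤ hi - lo + g.mesh n := by
  linarith [g.last_le n, g.lo_le_start n]

theorem pt_mem (n : ℕ) (i : Fin (g.num n)) : g.pt n i ∈ Icc lo hi := by
  have h1 := g.mesh_pos n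
  have h2 : (i : ℝ) ≤ (g.num n : ℝ) - 1 := by
    have : ((i : ℕ) : ℝ) + 1 ≤ g.num n := by exact_mod_cast i.2
    linarith
  have h3 : (i : ℝ) * g.mesh n ≤ ((g.num n : ℝ) - 1) * g.mesh n := by gcongr
  have h4 : (0 : ℝ) ≤ (i : ℝ) * g.mesh n := by positivity
  constructor
  · unfold pt; linarith [g.lo_le_start n]
  · unfold pt; linarith [g.last_le n]

/-- Ensures that the first `d` values of `comp` are genuine eigenvectors and not the default `0`. -/
theorem eventually_le_num (h : lo < hi) (d : ℕ) : ∀ᶠ n in atTop, d ≤ g.num n := by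
  have h1 : Tendsto (fun n => ((d : ℝ) + 1) * g.mesh n) atTop (𝓝 (((d : ℝ) + 1) * 0)) :=
    g.mesh_tendsto.const_mul _
  rw [mul_zero] at h1
  filter_upwards [h1.eventually_lt_const (sub_pos.2 h)] with n hn
  have h2 : hi - lo ≤ ((g.num n : ℝ) + 1) * g.mesh n := by
    linarith [g.le_last n, g.start_le n]
  have h3 := lt_of_mul_lt_mul_right (hn.trans_le h2) (g.mesh_pos n).le
  have h4 : (d : ℝ) < g.num n := by linarith
  exact_mod_cast h4.le

end UniformGrid

/-! ### Least squares on an orthonormal system -/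

section LeastSquares

variable {ι κ : Type*} [Fintype ι] [Fintype κ]

theorem dotProduct_self_sub_sum {u : κ → ι → ℝ} (hu : ∀ a b, a ≠ b → u a ⬝ᵥ u b = 0)
    (x : ι → ℝ) (b : κ → ℝ) :
    (x - ∑ l, b l • u l) ⬝ᵥ (x - ∑ l, b l • u l) =
      x ⬝ᵥ x + ∑ l, (b l ^ 2 * (u l ⬝ᵥ u l) - 2 * b l * (u l ⬝ᵥ x)) := by
  have h1 : (∑ l, b l • u l) ⬝ᵥ (∑ l, b l • u l) = ∑ l, b l ^ 2 * (u l ⬝ᵥ u l) := by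
    rw [sum_dotProduct]
    refine Finset.sum_congr rfl fun l _ => ?_
    rw [dotProduct_sum, Finset.sum_eq_single l]
    · simp only [smul_dotProduct, dotProduct_smul, smul_eq_mul]; ring
    · intro l' _ hl'
      simp [hu l l' hl'.symm]
    · simp
  have h2 : x ⬝ᵥ (∑ l, b l • u l) = ∑ l, b l * (u l ⬝ᵥ x) := by
    rw [dotProduct_sum]
    exact Finset.sum_congr rfl fun l _ => by rw [dotProduct_smul, dotProduct_comm, smul_eq_mul]
  rw [sub_dotProduct, dotProduct_sub, dotProduct_sub, h1, dotProduct_comm (∑ l, b l • u l) x, h2,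
    Finset.sum_sub_distrib]
  have : ∑ l, 2 * b l * (u l ⬝ᵥ x) = 2 * ∑ l, b l * (u l ⬝ᵥ x) := by
    rw [Finset.mul_sum]; exact Finset.sum_congr rfl fun l _ => by ring
  rw [this]
  ring

/-- Completing the square in each `b l`. The alternative `u a = 0` covers `k` larger than the number
of sampling times, where `comp` is padded with zeros. -/
theorem le_dotProduct_self_sub_sum {u : κ → ι → ℝ} (hu : ∀ a b, a ≠ b → u a ⬝ᵥ u b = 0)
    (hu1 : ∀ a, u a = 0 ∨ u a ⬝ᵥ u a = 1) (x : ι → ℝ) (b : κ → ℝ) :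
    x ⬝ᵥ x - ∑ l, (u l ⬝ᵥ x) ^ 2 ≤ (x - ∑ l, b l • u l) ⬝ᵥ (x - ∑ l, b l • u l) := by
  rw [dotProduct_self_sub_sum hu, sub_eq_add_neg, ← Finset.sum_neg_distrib]
  gcongr with l _
  rcases hu1 l with h | h
  · simp [h]
  · rw [h]; nlinarith [sq_nonneg (b l - u l ⬝ᵥ x)]

theorem dotProduct_self_sub_projection {u : κ → ι → ℝ} (hu : ∀ a b, a ≠ b → u a ⬝ᵥ u b = 0)
    (hu1 : ∀ a, u a = 0 ∨ u a ⬝ᵥ u a = 1) (x : ι → ℝ) :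
    (x - ∑ l, (u l ⬝ᵥ x) • u l) ⬝ᵥ (x - ∑ l, (u l ⬝ᵥ x) • u l) =
      x ⬝ᵥ x - ∑ l, (u l ⬝ᵥ x) ^ 2 := by
  rw [dotProduct_self_sub_sum hu, sub_eq_add_neg, ← Finset.sum_neg_distrib]
  congr 1
  refine Finset.sum_congr rfl fun l _ => ?_
  rcases hu1 l with h | h
  · simp [h]
  · rw [h]; ring

end LeastSquares

/-! ### The data matrix and its principal components -/

namespace FactorModel

variable {Ω : Type*} [MeasurableSpace Ω] {P : Measure Ω} {d : ℕ} (m : FactorModel P d)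

/-- The matrix `√ρ Z_{t_i}`. -/
def factorMat (n : ℕ) (ω : Ω) : Matrix (Fin (m.time.num n)) (Fin d) ℝ :=
  Matrix.of fun i k => √(m.time.mesh n) * m.Zs n i ω k

/-- The matrix `√δ λ(x_j)`. -/
def loadMat (N : ℕ) : Matrix (Fin (m.space.num N)) (Fin d) ℝ :=
  Matrix.of fun j k => √(m.space.mesh N) * m.lams N j k

/-- The matrix `√(ρδ) ε_{t_i}(x_j)`. -/
def errMat (n N : ℕ) (ω : Ω) : Matrix (Fin (m.time.num n)) (Fin (m.space.num N)) ℝ :=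
  Matrix.of fun i j => √(m.time.mesh n) * √(m.space.mesh N) * m.err n N i j ω

/-- The matrix `√(ρδ) X_{t_i}(x_j)`. -/
def scaledData (n N : ℕ) (ω : Ω) : Matrix (Fin (m.time.num n)) (Fin (m.space.num N)) ℝ :=
  (√(m.time.mesh n) * √(m.space.mesh N)) • m.data n N ω

theorem scaledData_eq (n N : ℕ) (ω : Ω) :
    m.scaledData n N ω = m.factorMat n ω * (m.loadMat N)ᵀ + m.errMat n N ω := by
  ext i j
  simp only [scaledData, data, obs, r, factorMat, loadMat, errMat, Zs, lams, err,
    Matrix.smul_apply, Matrix.of_apply, Matrix.add_apply, Matrix.mul_apply, Matrix.transpose_apply,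
    smul_eq_mul]
  have : ∑ k, √(m.time.mesh n) * m.Z (m.time.pt n i) ω k *
      (√(m.space.mesh N) * m.lam k (m.space.pt N j)) = √(m.time.mesh n) * √(m.space.mesh N) *
        ∑ k, m.Z (m.time.pt n i) ω k * m.lam k (m.space.pt N j) := by
    rw [Finset.mul_sum]
    exact Finset.sum_congr rfl fun k _ => by ring
  rw [this]
  ring

/-- The eigenvalues of `ρδ 𝕏 𝕏ᵀ`, continued by zero. -/
def mu (y : m.Selection) (n N : ℕ) (ω : Ω) (j : ℕ) : ℝ :=
  ((m.scaledData n N ω)ᵀ *ᵥ m.comp y n N ω j) ⬝ᵥ ((m.scaledData n N ω)ᵀ *ᵥ m.comp y n N ω j)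

variable {m} {y : m.Selection}

theorem comp_of_lt {n N : ℕ} {ω : Ω} {j : ℕ} (h : j < m.time.num n) :
    m.comp y n N ω j = y n N ω ⟨j, h⟩ := by
  ext i; simp [comp, h]

theorem comp_of_le {n N : ℕ} {ω : Ω} {j : ℕ} (h : m.time.num n ≤ j) :
    m.comp y n N ω j = 0 := by
  ext i; simp [comp, h.not_gt]

theorem IsPrincipal.comp_orthogonal (hy : m.IsPrincipal y) (n N : ℕ) (ω : Ω) {a b : ℕ}
    (hab : a ≠ b) : m.comp y n N ω a ⬝ᵥ m.comp y n N ω b = 0 := by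
  obtain ⟨c, hc⟩ := hy n N ω
  rcases lt_or_ge a (m.time.num n) with ha | ha
  · rcases lt_or_ge b (m.time.num n) with hb | hb
    · rw [comp_of_lt ha, comp_of_lt hb, hc.orthonormal, if_neg (by simpa using hab)]
    · simp [comp_of_le hb]
  · simp [comp_of_le ha]

theorem IsPrincipal.comp_normalized (hy : m.IsPrincipal y) (n N : ℕ) (ω : Ω) (a : ℕ) :
    m.comp y n N ω a = 0 ∨ m.comp y n N ω a ⬝ᵥ m.comp y n N ω a = 1 := by
  obtain ⟨c, hc⟩ := hy n N ω
  rcases lt_or_ge a (m.time.num n) with ha | ha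
  · rw [comp_of_lt ha, hc.orthonormal, if_pos rfl]
    exact Or.inr rfl
  · exact Or.inl (comp_of_le ha)

theorem mu_nonneg (n N : ℕ) (ω : Ω) (j : ℕ) : 0 ≤ m.mu y n N ω j := dotProduct_self_nonneg' _

theorem mu_of_le {n N : ℕ} {ω : Ω} {j : ℕ} (h : m.time.num n ≤ j) : m.mu y n N ω j = 0 := by
  simp [mu, comp_of_le h]

theorem IsPrincipal.eigensystem (hy : m.IsPrincipal y) (n N : ℕ) (ω : Ω) :
    IsOrderedEigensystem (m.scaledData n N ω * (m.scaledData n N ω)ᵀ)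
      (fun j => m.mu y n N ω j) (y n N ω) := by
  obtain ⟨c, hc⟩ := hy n N ω
  set a := √(m.time.mesh n) * √(m.space.mesh N) with ha
  have hmul : m.scaledData n N ω * (m.scaledData n N ω)ᵀ =
      (a * a) • (m.data n N ω * (m.data n N ω)ᵀ) := by
    simp [scaledData, ← ha, smul_smul]
  have hmu : ∀ j : Fin (m.time.num n), m.mu y n N ω j = a * a * c j := fun j => by
    rw [mu, comp_of_lt j.2, Matrix.dotProduct_mulVec, Matrix.vecMul_mulVec,
      Matrix.transpose_transpose, hmul, ← Matrix.dotProduct_mulVec, Matrix.smul_mulVec, Fin.eta,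
      hc.eigen, dotProduct_smul, dotProduct_smul, hc.orthonormal]
    simp
  refine ⟨fun i j hij => ?_, hc.orthonormal, fun j => ?_⟩
  · simp only [hmu]
    exact mul_le_mul_of_nonneg_left (hc.antitone hij) (mul_self_nonneg a)
  · rw [hmul, Matrix.smul_mulVec, hc.eigen, smul_smul, hmu]

theorem IsPrincipal.mu_antitone (hy : m.IsPrincipal y) (n N : ℕ) (ω : Ω) :
    Antitone (m.mu y n N ω) := by
  intro i j hij
  rcases lt_or_ge j (m.time.num n) with hj | hj
  · exact (hy.eigensystem n N ω).antitone (a := ⟨i, hij.trans_lt hj⟩) (b := ⟨j, hj⟩) hij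
  · rw [mu_of_le hj]; exact mu_nonneg n N ω i

/-- The problem decouples into one projection for each column of the data. Summed over the columns,
the part captured by the `l`-th component is `mu l`. -/
theorem IsPrincipal.residual_eq (hy : m.IsPrincipal y) (n N : ℕ) (ω : Ω) (k : ℕ) :
    m.residual y n N ω k =
      fsq (m.scaledData n N ω) - ∑ l ∈ Finset.range k, m.mu y n N ω l := by
  set D := m.scaledData n N ω with hD
  have hρ := m.time.mesh_pos n
  have hδ := m.space.mesh_pos N
  let u : Fin k → Fin (m.time.num n) → ℝ := fun l => m.comp y n N ω l
  have hu : ∀ a b, a ≠ b → u a ⬝ᵥ u b = 0 := fun a b hab =>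
    hy.comp_orthogonal n N ω (by simpa [Fin.ext_iff] using hab)
  have hu1 : ∀ a, u a = 0 ∨ u a ⬝ᵥ u a = 1 := fun a => hy.comp_normalized n N ω a
  have hobj : ∀ L : Matrix (Fin (m.space.num N)) (Fin k) ℝ,
      m.time.mesh n * m.space.mesh N *
        ∑ i, ∑ j, (m.data n N ω i j - L j ⬝ᵥ m.Yhat y n N ω k i) ^ 2 =
      ∑ j, (D.col j - ∑ l, (√(m.space.mesh N) * L j l) • u l) ⬝ᵥ
        (D.col j - ∑ l, (√(m.space.mesh N) * L j l) • u l) := fun L => by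
    rw [Finset.sum_comm, Finset.mul_sum]
    refine Finset.sum_congr rfl fun j _ => ?_
    rw [Finset.mul_sum, dotProduct]
    refine Finset.sum_congr rfl fun i _ => ?_
    have h1 : (D.col j - ∑ l, (√(m.space.mesh N) * L j l) • u l) i =
        √(m.time.mesh n) * √(m.space.mesh N) *
          (m.data n N ω i j - L j ⬝ᵥ m.Yhat y n N ω k i) := by
      rw [Pi.sub_apply, mul_sub, Finset.sum_apply]
      congr 1
      rw [dotProduct, Finset.mul_sum]
      refine Finset.sum_congr rfl fun l _ => ?_
      have h0 := (Real.sqrt_pos.2 hρ).ne'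
      simp only [Pi.smul_apply, smul_eq_mul, Yhat, Matrix.of_apply, u]
      field_simp
    rw [h1]
    have h2 := Real.mul_self_sqrt hρ.le
    have h3 := Real.mul_self_sqrt hδ.le
    calc _ = (√(m.time.mesh n) * √(m.time.mesh n)) * (√(m.space.mesh N) * √(m.space.mesh N)) *
          (m.data n N ω i j - L j ⬝ᵥ m.Yhat y n N ω k i) ^ 2 := by rw [h2, h3]
      _ = _ := by ring
  have hval : fsq D - ∑ l ∈ Finset.range k, m.mu y n N ω l =
      ∑ j, (D.col j ⬝ᵥ D.col j - ∑ l, (u l ⬝ᵥ D.col j) ^ 2) := by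
    rw [Finset.sum_sub_distrib, ← fsq_transpose, Finset.sum_comm (t := Finset.univ (α := Fin k)),
      ← Fin.sum_univ_eq_sum_range]
    congr 1
    · simp [fsq, dotProduct, sq]
    · refine Finset.sum_congr rfl fun l _ => ?_
      rw [mu, dotProduct]
      refine Finset.sum_congr rfl fun j _ => ?_
      rw [← sq, dotProduct_comm (u l)]
      rfl
  rw [hval, residual]
  simp only [hobj]
  have hlow : ∀ L : Matrix (Fin (m.space.num N)) (Fin k) ℝ,
      ∑ j, (D.col j ⬝ᵥ D.col j - ∑ l, (u l ⬝ᵥ D.col j) ^ 2) ≤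
        ∑ j, (D.col j - ∑ l, (√(m.space.mesh N) * L j l) • u l) ⬝ᵥ
        (D.col j - ∑ l, (√(m.space.mesh N) * L j l) • u l) := fun L =>
    Finset.sum_le_sum fun j _ => le_dotProduct_self_sub_sum hu hu1 _ _
  refine le_antisymm ?_ (le_ciInf hlow)
  -- The minimizer consists of the projection coefficients. Only `√δ` has to be divided out, as the
  -- `√ρ` of the scaling cancels against the normalization of `Yhat`.
  refine (ciInf_le ⟨_, forall_mem_range.2 hlow⟩
    (Matrix.of fun j l => (√(m.space.mesh N))⁻¹ * (u l ⬝ᵥ D.col j))).trans_eq ?_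
  refine Finset.sum_congr rfl fun j _ => ?_
  rw [← dotProduct_self_sub_projection hu hu1]
  have h0 := (Real.sqrt_pos.2 hδ).ne'
  simp [h0]

/-- Since `mu` decreases, the increments `q - mu l` of the criterion are negative for `l < d` and
positive for `l ≥ d`, so `d` is the only minimizer. -/
theorem IsPrincipal.dim_eq (hy : m.IsPrincipal y) {q : ℕ → ℕ → ℝ} {kmax : ℕ}
    {dhat : ℕ → ℕ → Ω → ℕ} (hdhat : m.IsDimEstimator y q kmax dhat) (hd : 1 ≤ d)
    (hkmax : d ≤ kmax) {n N : ℕ} {ω : Ω} (h1 : q n N < m.mu y n N ω (d - 1))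
    (h2 : m.mu y n N ω d < q n N) : dhat n N ω = d := by
  obtain ⟨hmem, hmin⟩ := hdhat n N ω
  have hle := hmin d ⟨hd, hkmax⟩
  set k := dhat n N ω
  have hPC : ∀ k, m.PC y q n N ω k = fsq (m.scaledData n N ω) +
      ∑ l ∈ Finset.range k, (q n N - m.mu y n N ω l) := fun k => by
    rw [PC, hy.residual_eq, Finset.sum_sub_distrib]
    simp
    ring
  rw [hPC, hPC, add_le_add_iff_left] at hle
  by_contra hne
  rcases lt_or_gt_of_ne hne with hlt | hlt
  · refine hle.not_gt ?_
    rw [← Finset.sum_range_add_sum_Ico _ hlt.le]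
    have : ∑ l ∈ Finset.Ico k d, (q n N - m.mu y n N ω l) < 0 := by
      refine Finset.sum_neg (fun l hl => ?_) ⟨k, by simpa using hlt⟩
      have := hy.mu_antitone n N ω (show l ≤ d - 1 by have := (Finset.mem_Ico.1 hl).2; omega)
      linarith
    linarith
  · refine hle.not_gt ?_
    rw [← Finset.sum_range_add_sum_Ico _ hlt.le]
    have : 0 < ∑ l ∈ Finset.Ico d k, (q n N - m.mu y n N ω l) := by
      refine Finset.sum_pos (fun l hl => ?_) ⟨d, by simpa using hlt⟩
      have := hy.mu_antitone n N ω (Finset.mem_Ico.1 hl).1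
      linarith
    linarith

/-- The error part of the data. -/
def errGram (m : FactorModel P d) (n N : ℕ) (ω : Ω) :
    Matrix (Fin (m.time.num n)) (Fin (m.time.num n)) ℝ :=
  m.errMat n N ω * (m.errMat n N ω)ᵀ

/-- On the kernel of the transposed factor matrix the data coincide with the errors. Comparison with
`lowRank` would bring in the convergence in D2, which has no rate and could not be weighed against
`q`. -/
theorem IsPrincipal.mu_dim_le (hy : m.IsPrincipal y) (n N : ℕ) (ω : Ω) :
    m.mu y n N ω d ≤ √(fsq (m.errGram n N ω)) := by
  rcases lt_or_ge d (m.time.num n) with hd | hd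
  · refine (hy.eigensystem n N ω).eigenvalue_le_of_ker (m.factorMat n ω) _ (fun x hx => ?_)
      ⟨d, hd⟩ le_rfl
    have h1 : (m.scaledData n N ω)ᵀ *ᵥ x = (m.errMat n N ω)ᵀ *ᵥ x := by
      rw [scaledData_eq, Matrix.transpose_add, Matrix.add_mulVec, Matrix.transpose_mul,
        ← Matrix.mulVec_mulVec, hx, Matrix.mulVec_zero, zero_add]
    have h2 : ∀ D : Matrix (Fin (m.time.num n)) (Fin (m.space.num N)) ℝ,
        x ⬝ᵥ (D * Dᵀ) *ᵥ x = (Dᵀ *ᵥ x) ⬝ᵥ (Dᵀ *ᵥ x) := fun D => by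
      rw [Matrix.dotProduct_mulVec (Dᵀ *ᵥ x), Matrix.vecMul_mulVec, Matrix.transpose_transpose,
        ← Matrix.dotProduct_mulVec]
    rw [errGram, h2, h2, h1]
  · rw [mu_of_le hd]
    positivity

/-- The matrix `√ρ Z Σ_λ^{1/2}`. -/
def lowRank (m : FactorModel P d) (n : ℕ) (ω : Ω) : Matrix (Fin (m.time.num n)) (Fin d) ℝ :=
  m.factorMat n ω * m.rootLam

/-- Expanding `(F Bᵀ + E)(F Bᵀ + E)ᵀ - F Σ_λ Fᵀ` leaves `F (Bᵀ B - Σ_λ) Fᵀ`, `E Eᵀ` and the two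
mixed terms `F (E B)ᵀ`, `E B Fᵀ`. The constants come from using `‖X + Y‖² ≤ 2‖X‖² + 2‖Y‖²` twice. -/
theorem fsq_remainder_le (hroot : m.rootLamᵀ = m.rootLam)
    (hsq : m.rootLam * m.rootLam = m.sigmaLam) (n N : ℕ) (ω : Ω) :
    fsq (m.scaledData n N ω * (m.scaledData n N ω)ᵀ - m.lowRank n ω * (m.lowRank n ω)ᵀ) ≤
      4 * (fsq (m.factorMat n ω) * fsq ((m.loadMat N)ᵀ * m.loadMat N - m.sigmaLam) *
          fsq (m.factorMat n ω)) +
        8 * (fsq (m.factorMat n ω) * fsq (m.errMat n N ω * m.loadMat N)) +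
        4 * fsq (m.errGram n N ω) := by
  set F := m.factorMat n ω
  set B := m.loadMat N
  set E := m.errMat n N ω with hE
  have h1 : m.scaledData n N ω * (m.scaledData n N ω)ᵀ - m.lowRank n ω * (m.lowRank n ω)ᵀ =
      (F * (Bᵀ * B - m.sigmaLam) * Fᵀ + E * Eᵀ) + (F * (E * B)ᵀ + (E * B) * Fᵀ) := by
    rw [scaledData_eq, lowRank, ← hsq]
    simp only [Matrix.transpose_mul, Matrix.transpose_add, Matrix.transpose_transpose, hroot,
      Matrix.mul_add, Matrix.add_mul, Matrix.mul_sub, Matrix.sub_mul, Matrix.mul_assoc, F, B, E]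
    abel
  rw [h1]
  have h2 : fsq (F * (Bᵀ * B - m.sigmaLam) * Fᵀ) ≤ fsq F * fsq (Bᵀ * B - m.sigmaLam) * fsq F := by
    refine (fsq_mul_le _ _).trans ?_
    rw [fsq_transpose]
    exact mul_le_mul_of_nonneg_right (fsq_mul_le _ _) (fsq_nonneg _)
  have h3 : fsq (F * (E * B)ᵀ) ≤ fsq F * fsq (E * B) := by
    simpa only [fsq_transpose] using fsq_mul_le F (E * B)ᵀ
  have h4 : fsq ((E * B) * Fᵀ) ≤ fsq F * fsq (E * B) := by
    rw [mul_comm (fsq F)]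
    simpa only [fsq_transpose] using fsq_mul_le (E * B) Fᵀ
  have h5 := fsq_add_le (F * (Bᵀ * B - m.sigmaLam) * Fᵀ + E * Eᵀ) (F * (E * B)ᵀ + (E * B) * Fᵀ)
  have h6 := fsq_add_le (F * (Bᵀ * B - m.sigmaLam) * Fᵀ) (E * Eᵀ)
  have h7 := fsq_add_le (F * (E * B)ᵀ) ((E * B) * Fᵀ)
  have h8 : m.errGram n N ω = E * Eᵀ := rfl
  rw [h8]
  linarith

end FactorModel

/-! ### Moment bounds for the errors -/

section Moments

variable {ι Ω : Type*} [MeasurableSpace Ω] {P : Measure Ω} {l : Filter ι}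

theorem tendsto_whp_of_integral_le {f : ι → Ω → ℝ} {b : ι → ℝ}
    (hf : ∀ p, Measurable (f p)) (hf0 : ∀ p ω, 0 ≤ f p ω)
    (hb : ∀ᶠ p in l, Integrable (f p) P ∧ ∫ ω, f p ω ∂P ≤ b p) (hb0 : Tendsto b l (𝓝 0)) :
    Tendsto (fun x : ι × Ω => f x.1 x.2) (whp l P) (𝓝 0) := by
  refine tendsto_whp_of_lintegral_le (fun p => (hf p).aemeasurable) hf0 ?_ hb0
  filter_upwards [hb] with p hp
  rw [← ofReal_integral_eq_lintegral_ofReal hp.1 (ae_of_all _ (hf0 p))]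
  exact ENNReal.ofReal_le_ofReal hp.2

theorem integrable_of_lintegral_ofReal_lt_top {f : Ω → ℝ} (hf : Measurable f) (hf0 : ∀ ω, 0 ≤ f ω)
    (h : ∫⁻ ω, ENNReal.ofReal (f ω) ∂P < ⊤) : Integrable f P :=
  (lintegral_ofReal_ne_top_iff_integrable hf.aestronglyMeasurable (ae_of_all _ hf0)).1 h.ne

/-- From `u² ≤ 1 + u⁴`. The `max C 0` reflects the truncation in `ENNReal.ofReal C`. -/
theorem integral_sq_le_of_moment_four [IsProbabilityMeasure P] {f : Ω → ℝ} {C : ℝ}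
    (hf : Measurable f) (h : ∫⁻ ω, ENNReal.ofReal (|f ω| ^ 4) ∂P ≤ ENNReal.ofReal C) :
    Integrable (fun ω => f ω ^ 2) P ∧ ∫ ω, f ω ^ 2 ∂P ≤ 1 + max C 0 := by
  have hint : Integrable (fun ω => |f ω| ^ 4) P :=
    integrable_of_lintegral_ofReal_lt_top (by fun_prop) (fun ω => by positivity)
      (h.trans_lt ENNReal.ofReal_lt_top)
  have hle : ∀ ω, f ω ^ 2 ≤ 1 + |f ω| ^ 4 := fun ω => by
    have : |f ω| ^ 4 = (f ω ^ 2) ^ 2 := by rw [← sq_abs (f ω)]; ring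
    rw [this]
    nlinarith [sq_nonneg (f ω ^ 2 - 1)]
  have hint2 : Integrable (fun ω => 1 + |f ω| ^ 4) P := (integrable_const 1).add hint
  have hsq : Integrable (fun ω => f ω ^ 2) P := by
    refine hint2.mono' (by fun_prop) (ae_of_all _ fun ω => ?_)
    rw [Real.norm_eq_abs, abs_of_nonneg (sq_nonneg _)]
    exact hle ω
  refine ⟨hsq, (integral_mono hsq hint2 hle).trans ?_⟩
  rw [integral_add (integrable_const 1) hint]
  have h2 : ∫ ω, |f ω| ^ 4 ∂P ≤ max C 0 := by
    rw [integral_eq_lintegral_of_nonneg_ae (ae_of_all _ fun ω => by positivity)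
      hint.aestronglyMeasurable]
    exact (ENNReal.toReal_mono ENNReal.ofReal_ne_top h).trans_eq (ENNReal.toReal_ofReal' ..)
  simpa using h2

end Moments

namespace FactorModel

variable {Ω : Type*} [MeasurableSpace Ω] {P : Measure Ω} {d : ℕ} {m : FactorModel P d}

theorem measurable_err (n N : ℕ) (i : Fin (m.time.num n)) (j : Fin (m.space.num N)) :
    Measurable (m.err n N i j) :=
  m.eps_measurable n N _ (m.time.pt_mem n i) _ (m.space.pt_mem N j)

theorem measurable_fsq_errGram (n N : ℕ) : Measurable fun ω => fsq (m.errGram n N ω) := by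
  have := measurable_err (m := m) n N
  simp only [fsq, errGram, Matrix.mul_apply, errMat, Matrix.of_apply, Matrix.transpose_apply]
  fun_prop

theorem measurable_fsq_errMat_mul (n N : ℕ) :
    Measurable fun ω => fsq (m.errMat n N ω * m.loadMat N) := by
  have := measurable_err (m := m) n N
  simp only [fsq, Matrix.mul_apply, errMat, Matrix.of_apply]
  fun_prop

variable [IsProbabilityMeasure P]

theorem D3.memLp_err (h : m.D3) (n N : ℕ) (i : Fin (m.time.num n)) (j : Fin (m.space.num N)) :
    MemLp (m.err n N i j) 2 P := by
  have hmeas := measurable_err n N i j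
  have h8 : Integrable (fun ω => |m.err n N i j ω| ^ 8) P := by
    refine integrable_of_lintegral_ofReal_lt_top (by fun_prop) (fun ω => by positivity) ?_
    refine lt_of_le_of_lt (lintegral_mono fun ω => ?_) (h.moment_eight n N)
    exact le_iSup₂ (f := fun i j => ENNReal.ofReal (|m.err n N i j ω| ^ 8)) i j
  rw [memLp_two_iff_integrable_sq hmeas.aestronglyMeasurable]
  refine ((integrable_const 1).add h8).mono' (by fun_prop) (ae_of_all _ fun ω => ?_)
  rw [Real.norm_eq_abs, abs_of_nonneg (sq_nonneg _), ← sq_abs]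
  simp only [Pi.add_apply]
  have h0 := abs_nonneg (m.err n N i j ω)
  rcases le_total (|m.err n N i j ω|) 1 with h1 | h1
  · exact (pow_le_one₀ h0 h1).trans (by simp)
  · exact (pow_le_pow_right₀ h1 (by norm_num : 2 ≤ 8)).trans (by simp)

theorem D3.integrable_err_mul (h : m.D3) (n N : ℕ) (i k : Fin (m.time.num n))
    (j l : Fin (m.space.num N)) :
    Integrable (fun ω => m.err n N i j ω * m.err n N k l ω) P :=
  (h.memLp_err n N i j).integrable_mul (h.memLp_err n N k l)

theorem D3.gammaN_eq (h : m.D3) (n N : ℕ) (i k : Fin (m.time.num n)) :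
    m.gammaN n N i k = m.space.mesh N * ∑ l, m.errCov n N i l k l := by
  rw [gammaN, integral_finsetSum _ fun l _ => h.integrable_err_mul n N i k l l]
  rfl

/-- Follows from `2|uv| ≤ u² + v²`. It extends the uniform bound on the diagonal of `gammaN` to all
entries. -/
theorem D3.abs_gammaN_le (h : m.D3) (n N : ℕ) (i k : Fin (m.time.num n)) :
    |m.gammaN n N i k| ≤ (m.gammaN n N i i + m.gammaN n N k k) / 2 := by
  have hδ := m.space.mesh_pos N
  have h1 : ∀ l, |m.errCov n N i l k l| ≤ (m.errCov n N i l i l + m.errCov n N k l k l) / 2 :=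
    fun l => by
      unfold errCov
      rw [← integral_add (h.integrable_err_mul n N i i l l) (h.integrable_err_mul n N k k l l),
        ← integral_div]
      refine (abs_integral_le_integral_abs).trans (integral_mono ?_ ?_ fun ω => ?_)
      · exact (h.integrable_err_mul n N i k l l).abs
      · exact ((h.integrable_err_mul n N i i l l).add (h.integrable_err_mul n N k k l l)).div_const 2
      · simp only
        rw [abs_le]
        constructor <;>
        nlinarith [sq_nonneg (m.err n N i l ω - m.err n N k l ω),
          sq_nonneg (m.err n N i l ω + m.err n N k l ω)]
  rw [h.gammaN_eq, h.gammaN_eq, h.gammaN_eq, abs_mul, abs_of_pos hδ, ← mul_add, mul_div_assoc]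
  refine mul_le_mul_of_nonneg_left ((Finset.abs_sum_le_sum_abs _ _).trans ?_) hδ.le
  rw [← Finset.sum_add_distrib, Finset.sum_div]
  exact Finset.sum_le_sum fun l _ => h1 l

/-- The centred and normalized inner products of the errors. -/
def errDev (m : FactorModel P d) (n N : ℕ) (i k : Fin (m.time.num n)) (ω : Ω) : ℝ :=
  √(m.space.mesh N) * ∑ l, (m.err n N i l ω * m.err n N k l ω - m.errCov n N i l k l)

theorem D3.errGram_apply (h : m.D3) (n N : ℕ) (ω : Ω) (i k : Fin (m.time.num n)) :
    m.errGram n N ω i k = m.time.mesh n *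
      (m.gammaN n N i k + √(m.space.mesh N) * m.errDev n N i k ω) := by
  have h1 := Real.mul_self_sqrt (m.time.mesh_pos n).le
  have h2 := Real.mul_self_sqrt (m.space.mesh_pos N).le
  have h3 : m.errGram n N ω i k = m.time.mesh n * m.space.mesh N *
      ∑ l, m.err n N i l ω * m.err n N k l ω := by
    rw [errGram, Matrix.mul_apply, Finset.mul_sum]
    refine Finset.sum_congr rfl fun l _ => ?_
    simp only [errMat, Matrix.of_apply, Matrix.transpose_apply]
    calc _ = (√(m.time.mesh n) * √(m.time.mesh n)) * (√(m.space.mesh N) * √(m.space.mesh N)) *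
          (m.err n N i l ω * m.err n N k l ω) := by ring
      _ = _ := by rw [h1, h2]
  rw [h3, h.gammaN_eq, errDev, ← mul_assoc (√(m.space.mesh N)), h2, Finset.sum_sub_distrib]
  ring

/-- By `errGram_apply` each entry is a mean plus a centred fluctuation. The squared means sum to
`O(ρ)`, because one factor `|γ|` is bounded and `ρ ∑ |γ|` is too. The fluctuations number `O(ρ⁻²)`
and contribute `ρ² δ` times a bounded second moment each. -/
theorem D3.integral_fsq_errGram_le (h : m.D3) : ∃ K : ℝ, ∀ n N, m.time.mesh n ≤ 1 →
    Integrable (fun ω => fsq (m.errGram n N ω)) P ∧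
      ∫ ω, fsq (m.errGram n N ω) ∂P ≤ K * (m.time.mesh n + m.space.mesh N) := by
  obtain ⟨C₁, hC₁⟩ := h.gamma_diag
  obtain ⟨C₂, hC₂⟩ := h.gamma_sum
  obtain ⟨C₄, hC₄⟩ := h.moment_four
  refine ⟨2 * |C₁| * |C₂| + 2 * (m.T + 1) ^ 2 * (1 + max C₄ 0), fun n N hn => ?_⟩
  set ρ := m.time.mesh n with hρdef
  set δ := m.space.mesh N with hδdef
  have hρ : 0 < ρ := m.time.mesh_pos n
  have hδ : 0 < δ := m.space.mesh_pos N
  have hT := m.T_pos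
  have hdev : ∀ i k, Integrable (fun ω => m.errDev n N i k ω ^ 2) P ∧
      ∫ ω, m.errDev n N i k ω ^ 2 ∂P ≤ 1 + max C₄ 0 := fun i k => by
    refine integral_sq_le_of_moment_four ?_ (hC₄ n N i k)
    have := measurable_err (m := m) n N
    unfold errDev
    fun_prop
  have hle : ∀ ω, fsq (m.errGram n N ω) ≤ ∑ i, ∑ k, (2 * ρ ^ 2 * m.gammaN n N i k ^ 2 +
      2 * ρ ^ 2 * δ * m.errDev n N i k ω ^ 2) := fun ω => by
    unfold fsq
    refine Finset.sum_le_sum fun i _ => Finset.sum_le_sum fun k _ => ?_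
    rw [h.errGram_apply]
    have h2 := Real.sq_sqrt hδ.le
    calc _ = ρ ^ 2 * (m.gammaN n N i k + √δ * m.errDev n N i k ω) ^ 2 := by ring
      _ ≤ ρ ^ 2 * (2 * (m.gammaN n N i k ^ 2 + (√δ * m.errDev n N i k ω) ^ 2)) := by
        gcongr; exact add_sq_le
      _ = _ := by rw [mul_pow, h2]; ring
  have hterm : ∀ i k, Integrable (fun ω => 2 * ρ ^ 2 * m.gammaN n N i k ^ 2 +
      2 * ρ ^ 2 * δ * m.errDev n N i k ω ^ 2) P := fun i k =>
    (integrable_const _).add ((hdev i k).1.const_mul _)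
  have hbound : Integrable (fun ω => ∑ i, ∑ k, (2 * ρ ^ 2 * m.gammaN n N i k ^ 2 +
      2 * ρ ^ 2 * δ * m.errDev n N i k ω ^ 2)) P :=
    integrable_finsetSum _ fun i _ => integrable_finsetSum _ fun k _ => hterm i k
  have hint : Integrable (fun ω => fsq (m.errGram n N ω)) P := by
    refine hbound.mono' (measurable_fsq_errGram n N).aestronglyMeasurable (ae_of_all _ fun ω => ?_)
    rw [Real.norm_eq_abs, abs_of_nonneg (fsq_nonneg _)]
    exact hle ω
  refine ⟨hint, (integral_mono hint hbound hle).trans ?_⟩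
  rw [integral_finsetSum _ fun i _ => integrable_finsetSum _ fun k _ => hterm i k]
  have hstep : ∀ i, ∫ ω, ∑ k, (2 * ρ ^ 2 * m.gammaN n N i k ^ 2 +
      2 * ρ ^ 2 * δ * m.errDev n N i k ω ^ 2) ∂P ≤
      ∑ k, (2 * ρ ^ 2 * (|C₁| * |m.gammaN n N i k|) + 2 * ρ ^ 2 * δ * (1 + max C₄ 0)) := fun i => by
    rw [integral_finsetSum _ fun k _ => hterm i k]
    refine Finset.sum_le_sum fun k _ => ?_
    rw [integral_add (integrable_const _) ((hdev i k).1.const_mul _), integral_const_mul]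
    have hγ : |m.gammaN n N i k| ≤ |C₁| := by
      refine (h.abs_gammaN_le n N i k).trans ?_
      linarith [hC₁ n N i, hC₁ n N k, le_abs_self C₁]
    have hγ2 : m.gammaN n N i k ^ 2 ≤ |C₁| * |m.gammaN n N i k| := by
      rw [← sq_abs, sq]
      exact mul_le_mul_of_nonneg_right hγ (abs_nonneg _)
    simp only [integral_const, probReal_univ, smul_eq_mul, one_mul]
    gcongr
    rw [integral_const_mul]
    gcongr
    exact (hdev i k).2
  refine (Finset.sum_le_sum fun i _ => hstep i).trans ?_
  simp only [Finset.sum_add_distrib, ← Finset.mul_sum, Finset.sum_const, Finset.card_univ,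
    Fintype.card_fin, nsmul_eq_mul]
  have hnum : (m.time.num n : ℝ) * ρ ≤ m.T + 1 := by
    linarith [m.time.num_mul_mesh_le n]
  have hnum2 : ((m.time.num n : ℝ) * ρ) ^ 2 ≤ (m.T + 1) ^ 2 := by gcongr
  have hsum : ρ * ∑ i, ∑ k, |m.gammaN n N i k| ≤ |C₂| := (hC₂ n N).trans (le_abs_self _)
  have hM : 0 ≤ 1 + max C₄ 0 := by positivity
  calc _ = 2 * ρ * |C₁| * (ρ * ∑ i, ∑ k, |m.gammaN n N i k|) +
        2 * ((m.time.num n : ℝ) * ρ) ^ 2 * δ * (1 + max C₄ 0) := by ring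
    _ ≤ 2 * ρ * |C₁| * |C₂| + 2 * (m.T + 1) ^ 2 * δ * (1 + max C₄ 0) := by gcongr
    _ ≤ _ := by
      have h1 : 0 ≤ 2 * |C₁| * |C₂| * δ := by positivity
      have h2 : 0 ≤ 2 * (m.T + 1) ^ 2 * (1 + max C₄ 0) * ρ := by positivity
      linarith

omit [IsProbabilityMeasure P] in
theorem fsq_errMat_mul_eq (n N : ℕ) (ω : Ω) :
    fsq (m.errMat n N ω * m.loadMat N) = m.time.mesh n * m.space.mesh N ^ 2 *
      ∑ i, ∑ j, ∑ l, (m.lams N j ⬝ᵥ m.lams N l) * (m.err n N i j ω * m.err n N i l ω) := by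
  have h1 := Real.sq_sqrt (m.time.mesh_pos n).le
  have h2 := Real.sq_sqrt (m.space.mesh_pos N).le
  rw [fsq, Finset.mul_sum]
  refine Finset.sum_congr rfl fun i _ => ?_
  have h3 : ∀ k, (m.errMat n N ω * m.loadMat N) i k ^ 2 = m.time.mesh n * m.space.mesh N ^ 2 *
      ∑ j, ∑ l, (m.lams N j k * m.lams N l k) * (m.err n N i j ω * m.err n N i l ω) := fun k => by
    have h4 : (m.errMat n N ω * m.loadMat N) i k = √(m.time.mesh n) * √(m.space.mesh N) ^ 2 *
        ∑ j, m.err n N i j ω * m.lams N j k := by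
      rw [Matrix.mul_apply, Finset.mul_sum]
      refine Finset.sum_congr rfl fun j _ => ?_
      simp only [errMat, loadMat, Matrix.of_apply]
      ring
    rw [h4, mul_pow, mul_pow, h1, h2, sq (∑ j, _), Finset.sum_mul_sum]
    congr 1
    refine Finset.sum_congr rfl fun j _ => Finset.sum_congr rfl fun l _ => by ring
  simp only [h3]
  rw [← Finset.mul_sum, Finset.sum_comm]
  congr 1
  refine Finset.sum_congr rfl fun j _ => ?_
  rw [Finset.sum_comm]
  refine Finset.sum_congr rfl fun l _ => ?_
  rw [dotProduct, Finset.sum_mul]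

/-- Bounded loadings reduce the expectation to the summed spatial covariances at a single time.
These cost one factor `1/δ` out of `δ²`, and the sum over times is absorbed by `ρ`. -/
theorem D3.integral_fsq_errMat_mul_le (h : m.D3) (h2 : m.D2) :
    ∃ K : ℝ, ∀ n N, m.time.mesh n ≤ 1 →
      Integrable (fun ω => fsq (m.errMat n N ω * m.loadMat N)) P ∧
        ∫ ω, fsq (m.errMat n N ω * m.loadMat N) ∂P ≤ K * m.space.mesh N := by
  obtain ⟨C, hC⟩ := h2.bounded
  obtain ⟨C₃, hC₃⟩ := h.cov_space
  refine ⟨(m.T + 1) * C ^ 2 * |C₃|, fun n N hn => ?_⟩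
  set ρ := m.time.mesh n with hρdef
  set δ := m.space.mesh N with hδdef
  have hρ : 0 < ρ := m.time.mesh_pos n
  have hδ : 0 < δ := m.space.mesh_pos N
  have hT := m.T_pos
  have hlam : ∀ j l, |m.lams N j ⬝ᵥ m.lams N l| ≤ C ^ 2 := fun j l => by
    refine (abs_dotProduct_le _ _).trans ?_
    have hdot : ∀ j, √(m.lams N j ⬝ᵥ m.lams N j) ≤ C := fun j => by
      simpa [dotProduct, sq] using hC N j
    rw [sq]
    exact mul_le_mul (hdot j) (hdot l) (Real.sqrt_nonneg _) ((Real.sqrt_nonneg _).trans (hdot j))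
  simp only [fsq_errMat_mul_eq]
  have hi0 : ∀ i j l, Integrable (fun ω => (m.lams N j ⬝ᵥ m.lams N l) *
      (m.err n N i j ω * m.err n N i l ω)) P := fun i j l =>
    (h.integrable_err_mul n N i i j l).const_mul _
  have hi1 : ∀ i j, Integrable (fun ω => ∑ l, (m.lams N j ⬝ᵥ m.lams N l) *
      (m.err n N i j ω * m.err n N i l ω)) P := fun i j =>
    integrable_finsetSum _ fun l _ => hi0 i j l
  have hi2 : ∀ i, Integrable (fun ω => ∑ j, ∑ l, (m.lams N j ⬝ᵥ m.lams N l) *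
      (m.err n N i j ω * m.err n N i l ω)) P := fun i =>
    integrable_finsetSum _ fun j _ => hi1 i j
  refine ⟨(integrable_finsetSum _ fun i _ => hi2 i).const_mul _, ?_⟩
  rw [integral_const_mul, integral_finsetSum _ fun i _ => hi2 i]
  have hstep : ∀ i, ∫ ω, ∑ j, ∑ l, (m.lams N j ⬝ᵥ m.lams N l) *
      (m.err n N i j ω * m.err n N i l ω) ∂P ≤
      C ^ 2 * ∑ l, ∑ j, (⨆ i, |m.errCov n N i j i l|) := fun i => by
    rw [integral_finsetSum _ fun j _ => hi1 i j, Finset.sum_comm, Finset.mul_sum]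
    refine Finset.sum_le_sum fun j _ => ?_
    rw [integral_finsetSum _ fun l _ => hi0 i j l, Finset.mul_sum]
    refine Finset.sum_le_sum fun l _ => ?_
    rw [integral_const_mul]
    refine (le_abs_self _).trans ?_
    rw [abs_mul]
    exact mul_le_mul (hlam j l)
      (le_ciSup (f := fun i => |m.errCov n N i j i l|) (finite_range _).bddAbove i)
      (abs_nonneg _) (sq_nonneg _)
  have hnum : (m.time.num n : ℝ) * ρ ≤ m.T + 1 := by
    linarith [m.time.num_mul_mesh_le n]
  have hsum : δ * ∑ l, ∑ j, (⨆ i, |m.errCov n N i j i l|) ≤ |C₃| :=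
    (hC₃ n N).trans (le_abs_self _)
  calc _ ≤ ρ * δ ^ 2 * ∑ _i : Fin (m.time.num n),
        C ^ 2 * ∑ l, ∑ j, (⨆ i, |m.errCov n N i j i l|) := by
        gcongr with i _
        exact hstep i
    _ = (m.time.num n * ρ) * C ^ 2 * (δ * ∑ l, ∑ j, (⨆ i, |m.errCov n N i j i l|)) * δ := by
        simp only [Finset.sum_const, Finset.card_univ, Fintype.card_fin, nsmul_eq_mul]
        ring
    _ ≤ (m.time.num n * ρ) * C ^ 2 * |C₃| * δ := by gcongr
    _ ≤ _ := by gcongr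

end FactorModel

/-- Carries limits in `n` alone, as in D1, over to joint limits in `(n, N)`. -/
theorem tendsto_prodMap_whp {ι κ Ω : Type*} [MeasurableSpace Ω] {P : Measure Ω} {l : Filter ι}
    {l' : Filter κ} {g : ι → κ} (hg : Tendsto g l l') :
    Tendsto (Prod.map g (id : Ω → Ω)) (whp l P) (whp l' P) := by
  intro s hs
  have h : Tendsto (fun p => P {ω | (p, ω) ∉ s}) l' (𝓝 0) := hs
  exact h.comp hg

/-! ### The square root of `Σ_λ` -/

section Root

variable {Ω : Type*} [MeasurableSpace Ω] {P : Measure Ω} {d : ℕ} {m : FactorModel P d}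

open scoped MatrixOrder Matrix.Norms.L2Operator in
theorem FactorModel.D2.rootLam_mul_self (h : m.D2) : m.rootLam * m.rootLam = m.sigmaLam :=
  CFC.sqrt_mul_sqrt_self _ h.posDef.posSemidef.nonneg

open scoped MatrixOrder Matrix.Norms.L2Operator in
theorem FactorModel.rootLam_transpose (m : FactorModel P d) : m.rootLamᵀ = m.rootLam := by
  have h : IsSelfAdjoint (CFC.sqrt m.sigmaLam) := (CFC.sqrt_nonneg _).isSelfAdjoint
  have h2 : m.rootLamᴴ = m.rootLam := h
  rwa [Matrix.conjTranspose_eq_transpose_of_trivial] at h2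

theorem FactorModel.D2.isUnit_det_rootLam (h : m.D2) : IsUnit m.rootLam.det := by
  have h1 : m.rootLam.det * m.rootLam.det = m.sigmaLam.det := by
    rw [← Matrix.det_mul, h.rootLam_mul_self]
  have h2 : m.sigmaLam.det ≠ 0 := h.posDef.det_pos.ne'
  rw [← h1] at h2
  exact isUnit_iff_ne_zero.2 (left_ne_zero_of_mul h2)

end Root

/-! ### Exhaustion of the probability space by events with well separated eigenvalues -/

theorem IsSeparated.mono {d : ℕ} {κ K κ' K' : ℝ} {c : Fin d → ℝ} {φ : Fin d → Fin d → ℝ}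
    (h : IsSeparated κ K c φ) (hκ : κ' ≤ κ) (hK : K ≤ K') : IsSeparated κ' K' c φ :=
  ⟨fun j => hκ.trans (h.lower j), fun j => (h.upper j).trans hK,
    fun i j hij => by linarith [h.gap i j hij], h.orthonormal⟩

namespace FactorModel

variable {Ω : Type*} [MeasurableSpace Ω] {P : Measure Ω} {d : ℕ} (m : FactorModel P d)

/-- The matrix `Σ_λ^{-1/2} Φ diag(c) Φᵀ Σ_λ^{-1/2}`, with `Φᵀ` in the argument. -/
def unroot (p : (Fin d → ℝ) × (Fin d → Fin d → ℝ)) : Fin d → Fin d → ℝ :=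
  m.rootLam⁻¹ * ((Matrix.of p.2)ᵀ * Matrix.diagonal p.1 * Matrix.of p.2) * m.rootLam⁻¹

theorem continuous_unroot : Continuous m.unroot := by
  refine continuous_pi fun i => continuous_pi fun j => ?_
  simp only [unroot, Matrix.mul_apply, Matrix.transpose_apply, Matrix.of_apply]
  fun_prop

/-- Matrices `Σ_Z` for which the limiting eigenvalues are separated. -/
def separatedSet (k : ℕ) : Set (Fin d → Fin d → ℝ) :=
  m.unroot '' {p | IsSeparated (1 / ((k : ℝ) + 1)) ((k : ℝ) + 1) p.1 p.2}

theorem isCompact_separatedSet (k : ℕ) : IsCompact (m.separatedSet k) :=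
  (isCompact_isSeparated (by positivity)).image m.continuous_unroot

theorem separatedSet_mono : Monotone m.separatedSet := by
  intro k l hkl
  have : (k : ℝ) ≤ l := by exact_mod_cast hkl
  refine image_mono fun p (hp : IsSeparated _ _ _ _) => hp.mono ?_ (by linarith)
  exact one_div_le_one_div_of_le (by positivity) (by linarith)

/-- The event that the limiting eigenvalues are separated. -/
def separatedEvent (k : ℕ) : Set Ω := {ω | m.sigmaZ ω ∈ m.separatedSet k}

theorem measurable_Zs (n : ℕ) (i : Fin (m.time.num n)) : Measurable (m.Zs n i) :=
  m.Z_measurable _ (m.time.pt_mem n i)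

variable {m}

theorem D1.aemeasurable_sigmaZ (h : m.D1) :
    AEMeasurable (fun ω i j => m.sigmaZ ω i j) P := by
  refine aemeasurable_pi_iff.2 fun i => aemeasurable_pi_iff.2 fun j => ?_
  refine TendstoInMeasure.aemeasurable (fun n => ?_) (h.tendsto i j)
  have := m.measurable_Zs n
  fun_prop

variable {c : Ω → Fin d → ℝ} {Φ : Ω → Matrix (Fin d) (Fin d) ℝ}

theorem sigmaZ_eq (h2 : m.D2) (ω : Ω) :
    m.sigmaZ ω = m.rootLam⁻¹ * (m.rootLam * m.sigmaZ ω * m.rootLam) * m.rootLam⁻¹ := by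
  have hu := h2.isUnit_det_rootLam
  rw [Matrix.mul_assoc, Matrix.mul_nonsing_inv_cancel_right _ _ hu,
    Matrix.nonsing_inv_mul_cancel_left _ _ hu]

/-- The system witnessing membership may differ from `(c, Φ)`, but the ordered eigenvalues are
determined by the matrix, so the separation passes to `c`. -/
theorem IsLimitEigensystem.isSeparated (hΦ : m.IsLimitEigensystem c Φ) (h2 : m.D2) {k : ℕ} {ω : Ω}
    (hω : ω ∈ m.separatedEvent k) :
    IsSeparated (1 / ((k : ℝ) + 1)) ((k : ℝ) + 1) (c ω) (Φ ω)ᵀ := by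
  obtain ⟨p, hp, hpω⟩ := hω
  have hp' : IsSeparated (1 / ((k : ℝ) + 1)) ((k : ℝ) + 1) p.1 p.2 := hp
  have hu := h2.isUnit_det_rootLam
  have hV : m.rootLam * m.sigmaZ ω * m.rootLam =
      (Matrix.of p.2)ᵀ * Matrix.diagonal p.1 * Matrix.of p.2 := by
    have h3 : m.sigmaZ ω = m.rootLam⁻¹ *
      ((Matrix.of p.2)ᵀ * Matrix.diagonal p.1 * Matrix.of p.2) * m.rootLam⁻¹ := hpω.symm
    rw [h3, Matrix.mul_assoc m.rootLam⁻¹, Matrix.mul_nonsing_inv_cancel_left _ _ hu,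
      Matrix.nonsing_inv_mul_cancel_right _ _ hu]
  have hsys := hp'.isOrderedEigensystem (by positivity)
  rw [← hV] at hsys
  have hc := hsys.eigenvalue_unique (hΦ ω)
  exact ⟨hc ▸ hp'.lower, hc ▸ hp'.upper, hc ▸ hp'.gap, (hΦ ω).orthonormal⟩

theorem exists_sigmaZ_bound (k : ℕ) :
    ∃ K : ℝ, ∀ ω ∈ m.separatedEvent k, ∀ i j, |m.sigmaZ ω i j| ≤ K := by
  obtain ⟨K, hK⟩ := (m.isCompact_separatedSet k).isBounded.exists_norm_le
  refine ⟨K, fun ω hω i j => ?_⟩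
  have h1 := hK _ hω
  exact (norm_le_pi_norm (m.sigmaZ ω i) j).trans ((norm_le_pi_norm (m.sigmaZ ω) i).trans h1)

theorem IsLimitEigensystem.pos (hΦ : m.IsLimitEigensystem c Φ) (h2 : m.D2) {ω : Ω}
    (hω : (m.sigmaZ ω).PosDef) (j : Fin d) : 0 < c ω j := by
  have h := hΦ ω
  set φ := (Φ ω)ᵀ j
  have h1 : c ω j = φ ⬝ᵥ (m.rootLam * m.sigmaZ ω * m.rootLam) *ᵥ φ := by
    rw [h.eigen, dotProduct_smul, h.orthonormal]; simp
  have h3 : φ ⬝ᵥ (m.rootLam * m.sigmaZ ω * m.rootLam) *ᵥ φ =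
      (m.rootLam *ᵥ φ) ⬝ᵥ m.sigmaZ ω *ᵥ (m.rootLam *ᵥ φ) := by
    rw [← Matrix.mulVec_mulVec, ← Matrix.mulVec_mulVec, Matrix.dotProduct_mulVec φ m.rootLam]
    conv_lhs => rw [← m.rootLam_transpose, Matrix.vecMul_transpose, m.rootLam_transpose]
  have hne : m.rootLam *ᵥ φ ≠ 0 := fun h0 => by
    have h4 : φ = 0 := by
      have := congrArg (fun v => m.rootLam⁻¹ *ᵥ v) h0
      simpa [Matrix.mulVec_mulVec, Matrix.nonsing_inv_mul _ h2.isUnit_det_rootLam] using this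
    have h5 := h.orthonormal j j
    rw [if_pos rfl, show (Φ ω)ᵀ j = 0 from h4] at h5
    simp at h5
  rw [h1, h3]
  simpa using hω.dotProduct_mulVec_pos hne

/-- `Σ_λ Σ_Z` is conjugate to `Σ_λ^{1/2} Σ_Z Σ_λ^{1/2}` through `Σ_λ^{1/2}`. Its `d` distinct
eigenvalues all occur in the list `c` of length `d`, which therefore has no repetition. -/
theorem IsLimitEigensystem.strictAnti (hΦ : m.IsLimitEigensystem c Φ) (h2 : m.D2) {ω : Ω}
    (hω : (spectrum ℝ (m.sigmaLam * m.sigmaZ ω)).ncard = d) : StrictAnti (c ω) := by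
  have hu := h2.isUnit_det_rootLam
  have hspec : spectrum ℝ (m.sigmaLam * m.sigmaZ ω) =
      spectrum ℝ (m.rootLam * m.sigmaZ ω * m.rootLam) := by
    let U : (Matrix (Fin d) (Fin d) ℝ)ˣ := m.rootLam.nonsingInvUnit hu
    have h1 : m.sigmaLam * m.sigmaZ ω = (U : Matrix (Fin d) (Fin d) ℝ) *
        (m.rootLam * m.sigmaZ ω * m.rootLam) * (U⁻¹ : (Matrix (Fin d) (Fin d) ℝ)ˣ) := by
      change _ = m.rootLam * (m.rootLam * m.sigmaZ ω * m.rootLam) * m.rootLam⁻¹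
      rw [Matrix.mul_assoc, Matrix.mul_nonsing_inv_cancel_right _ _ hu, ← Matrix.mul_assoc,
        h2.rootLam_mul_self]
    rw [h1, spectrum.units_conjugate]
  rw [hspec] at hω
  have h3 : d ≤ (range (c ω)).ncard :=
    hω.symm.le.trans (ncard_le_ncard (hΦ ω).spectrum_subset (finite_range _))
  have hinj : Function.Injective (c ω) := by
    rw [← image_univ] at h3
    refine fun a b hab => (injOn_of_ncard_image_eq (s := univ) (f := c ω) ?_ finite_univ)
      (mem_univ a) (mem_univ b) hab
    refine le_antisymm (ncard_image_le finite_univ) ?_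
    simpa [ncard_univ] using h3
  exact (hΦ ω).antitone.strictAnti_of_injective hinj

theorem IsLimitEigensystem.mem_separatedEvent (hΦ : m.IsLimitEigensystem c Φ) (h2 : m.D2) {ω : Ω}
    (h1 : (m.sigmaZ ω).PosDef) (hq : (spectrum ℝ (m.sigmaLam * m.sigmaZ ω)).ncard = d) :
    ∃ k, ω ∈ m.separatedEvent k := by
  have hanti := hΦ.strictAnti h2 hq
  have hpos := hΦ.pos h2 h1
  have hlim := tendsto_one_div_add_atTop_nhds_zero_nat (𝕜 := ℝ)
  have e1 : ∀ᶠ k : ℕ in atTop, ∀ j, 1 / ((k : ℝ) + 1) ≤ c ω j :=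
    eventually_all.2 fun j => hlim.eventually_le_const (hpos j)
  have e2 : ∀ᶠ k : ℕ in atTop, ∀ j, c ω j ≤ (k : ℝ) + 1 :=
    eventually_all.2 fun j => by
      filter_upwards [tendsto_natCast_atTop_atTop.eventually_ge_atTop (c ω j)] with k hk
      linarith
  have e3 : ∀ᶠ k : ℕ in atTop, ∀ i j, i < j → 1 / ((k : ℝ) + 1) ≤ c ω i - c ω j :=
    eventually_all.2 fun i => eventually_all.2 fun j => by
      by_cases hij : i < j
      · filter_upwards [hlim.eventually_le_const (sub_pos.2 (hanti hij))] with k hk _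
        exact hk
      · exact Eventually.of_forall fun k h => absurd h hij
  obtain ⟨k, hk1, hk2, hk3⟩ := (e1.and (e2.and e3)).exists
  refine ⟨k, (c ω, (Φ ω)ᵀ), ⟨hk1, hk2, fun i j hij => by linarith [hk3 i j hij],
    (hΦ ω).orthonormal⟩, ?_⟩
  have h3 := (hΦ ω).eq_mul_diagonal_mul
  have h4 : m.sigmaZ ω = m.rootLam⁻¹ * ((Matrix.of (Φ ω)ᵀ)ᵀ * Matrix.diagonal (c ω) *
      Matrix.of (Φ ω)ᵀ) * m.rootLam⁻¹ := by
    rw [← h3]; exact sigmaZ_eq h2 ω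
  exact h4.symm

/-- Continuity from above for events that increase to almost everything. `c` and `Φ` are not known
to be measurable; the events are null measurable as preimages of compact sets under `Σ_Z`, itself a
limit in measure of measurable functions. -/
theorem IsLimitEigensystem.tendsto_measure_compl_separatedEvent [IsProbabilityMeasure P]
    (hΦ : m.IsLimitEigensystem c Φ) (h1 : m.D1) (h2 : m.D2) (hq : m.Q1) :
    Tendsto (fun k => P (m.separatedEvent k)ᶜ) atTop (𝓝 0) := by
  have hmeas : ∀ k, NullMeasurableSet (m.separatedEvent k)ᶜ P := fun k =>
    (h1.aemeasurable_sigmaZ.nullMeasurableSet_preimage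
      (m.isCompact_separatedSet k).isClosed.measurableSet).compl
  have hanti : Antitone fun k => (m.separatedEvent k)ᶜ := fun k l hkl =>
    compl_subset_compl.2 fun ω hω => m.separatedSet_mono hkl hω
  have hlim := tendsto_measure_iInter_atTop hmeas hanti ⟨0, measure_ne_top _ _⟩
  have h0 : P (⋂ k, (m.separatedEvent k)ᶜ) = 0 := by
    have : ∀ᵐ ω ∂P, ¬ ω ∈ ⋂ k, (m.separatedEvent k)ᶜ := by
      filter_upwards [h1.posDef, hq] with ω hω1 hω2 hmem
      obtain ⟨k, hk⟩ := hΦ.mem_separatedEvent h2 hω1 hω2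
      exact mem_iInter.1 hmem k hk
    exact measure_eq_zero_iff_ae_notMem.2 this
  rw [h0] at hlim
  exact hlim

end FactorModel

/-! ### Limits of the sample quantities with high probability -/

namespace FactorModel

variable {Ω : Type*} [MeasurableSpace Ω] {P : Measure Ω} {d : ℕ} {m : FactorModel P d}

theorem tendsto_time_mesh (m : FactorModel P d) :
    Tendsto (fun p : ℕ × ℕ => m.time.mesh p.1) atTop (𝓝 0) := by
  rw [← prod_atTop_atTop_eq]
  exact m.time.mesh_tendsto.comp tendsto_fst

theorem tendsto_space_mesh (m : FactorModel P d) :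
    Tendsto (fun p : ℕ × ℕ => m.space.mesh p.2) atTop (𝓝 0) := by
  rw [← prod_atTop_atTop_eq]
  exact m.space.mesh_tendsto.comp tendsto_snd

theorem factorMat_gram_apply (m : FactorModel P d) (n : ℕ) (ω : Ω) (j k : Fin d) :
    ((m.factorMat n ω)ᵀ * m.factorMat n ω) j k =
      m.time.mesh n * ∑ i, m.Zs n i ω j * m.Zs n i ω k := by
  have h1 := Real.mul_self_sqrt (m.time.mesh_pos n).le
  rw [Matrix.mul_apply, Finset.mul_sum]
  refine Finset.sum_congr rfl fun i _ => ?_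
  simp only [factorMat, Matrix.of_apply, Matrix.transpose_apply]
  calc _ = (√(m.time.mesh n) * √(m.time.mesh n)) * (m.Zs n i ω j * m.Zs n i ω k) := by ring
    _ = _ := by rw [h1]

theorem D1.tendsto_factorMat_gram (h : m.D1) (j k : Fin d) :
    Tendsto (fun x : (ℕ × ℕ) × Ω =>
      ((m.factorMat x.1.1 x.2)ᵀ * m.factorMat x.1.1 x.2 - m.sigmaZ x.2) j k)
      (whp atTop P) (𝓝 0) := by
  have h1 := tendstoInMeasure_iff_whp.1 (h.tendsto j k)
  have h2 : Tendsto (Prod.fst : ℕ × ℕ → ℕ) atTop atTop := by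
    rw [← prod_atTop_atTop_eq]; exact tendsto_fst
  refine (h1.comp (tendsto_prodMap_whp h2)).congr fun x => ?_
  rw [Matrix.sub_apply, factorMat_gram_apply]
  rfl

/-- The squared Frobenius norm is the trace of the Gram matrix, which is close to that of `Σ_Z`,
bounded on the event. -/
theorem D1.exists_fsq_factorMat_le (h : m.D1) (k : ℕ) :
    ∃ K : ℝ, 0 ≤ K ∧ ∀ᶠ x : (ℕ × ℕ) × Ω in whp atTop P ⊓ 𝓟 {x | x.2 ∈ m.separatedEvent k},
      fsq (m.factorMat x.1.1 x.2) ≤ K := by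
  obtain ⟨K, hK⟩ := exists_sigmaZ_bound (m := m) k
  refine ⟨d * (|K| + 1), by positivity, ?_⟩
  rw [eventually_inf_principal]
  have h1 : ∀ᶠ x : (ℕ × ℕ) × Ω in whp atTop P, ∀ j,
      ((m.factorMat x.1.1 x.2)ᵀ * m.factorMat x.1.1 x.2 - m.sigmaZ x.2) j j ≤ 1 :=
    eventually_all.2 fun j => (h.tendsto_factorMat_gram j j).eventually_le_const zero_lt_one
  filter_upwards [h1] with x hx hω
  have h2 : fsq (m.factorMat x.1.1 x.2) =
      ∑ j, ((m.factorMat x.1.1 x.2)ᵀ * m.factorMat x.1.1 x.2) j j := by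
    simp only [fsq, Matrix.mul_apply, Matrix.transpose_apply, ← sq]
    exact Finset.sum_comm
  rw [h2]
  refine (Finset.sum_le_card_nsmul _ _ (|K| + 1) fun j _ => ?_).trans_eq (by simp [nsmul_eq_mul, mul_add])
  have h3 := hx j
  rw [Matrix.sub_apply] at h3
  linarith [(le_abs_self _).trans ((hK x.2 hω j j).trans (le_abs_self K))]

theorem D1.tendsto_lowRank_gram (h : m.D1) :
    Tendsto (fun x : (ℕ × ℕ) × Ω => fsq ((m.lowRank x.1.1 x.2)ᵀ * m.lowRank x.1.1 x.2 -
      m.rootLam * m.sigmaZ x.2 * m.rootLam)) (whp atTop P) (𝓝 0) := by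
  have h1 := tendsto_fsq_zero h.tendsto_factorMat_gram
  have h2 := (h1.const_mul (fsq m.rootLam)).mul_const (fsq m.rootLam)
  rw [mul_zero, zero_mul] at h2
  refine squeeze_zero (fun x => fsq_nonneg _) (fun x => ?_) h2
  have h3 : (m.lowRank x.1.1 x.2)ᵀ * m.lowRank x.1.1 x.2 -
      m.rootLam * m.sigmaZ x.2 * m.rootLam = m.rootLam *
        ((m.factorMat x.1.1 x.2)ᵀ * m.factorMat x.1.1 x.2 - m.sigmaZ x.2) * m.rootLam := by
    rw [lowRank, Matrix.transpose_mul, m.rootLam_transpose]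
    simp only [Matrix.mul_sub, Matrix.sub_mul, Matrix.mul_assoc]
  rw [h3]
  exact (fsq_mul_le _ _).trans (mul_le_mul_of_nonneg_right (fsq_mul_le _ _) (fsq_nonneg _))

theorem D2.tendsto_loadMat (h : m.D2) :
    Tendsto (fun x : (ℕ × ℕ) × Ω => fsq ((m.loadMat x.1.2)ᵀ * m.loadMat x.1.2 - m.sigmaLam))
      (whp atTop P) (𝓝 0) := by
  refine tendsto_fsq_zero fun i j => ?_
  have h1 := tendsto_pi_nhds.1 (tendsto_pi_nhds.1 h.tendsto i) j
  have h2 : Tendsto (fun x : (ℕ × ℕ) × Ω => x.1.2) (whp atTop P) atTop := by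
    have h3 : Tendsto (Prod.snd : ℕ × ℕ → ℕ) atTop atTop := by
      rw [← prod_atTop_atTop_eq]; exact tendsto_snd
    exact h3.comp tendsto_fst_whp
  have h4 := (h1.comp h2).sub_const (m.sigmaLam i j)
  rw [sub_self] at h4
  refine h4.congr fun x => ?_
  have h5 := Real.mul_self_sqrt (m.space.mesh_pos x.1.2).le
  simp only [Function.comp_apply, Matrix.sub_apply, Matrix.smul_apply, Matrix.sum_apply,
    Matrix.vecMulVec_apply, smul_eq_mul, Matrix.mul_apply, Matrix.transpose_apply, loadMat,
    Matrix.of_apply]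
  rw [Finset.mul_sum]
  congr 1
  refine Finset.sum_congr rfl fun k _ => ?_
  calc _ = (√(m.space.mesh x.1.2) * √(m.space.mesh x.1.2)) *
      (m.lams x.1.2 k i * m.lams x.1.2 k j) := by rw [h5]
    _ = _ := by ring

theorem eventually_time_mesh_le_one (m : FactorModel P d) :
    ∀ᶠ p : ℕ × ℕ in atTop, m.time.mesh p.1 ≤ 1 :=
  m.tendsto_time_mesh.eventually_le_const zero_lt_one

section

variable [IsProbabilityMeasure P]

theorem D3.tendsto_errMat_mul (h : m.D3) (h2 : m.D2) :
    Tendsto (fun x : (ℕ × ℕ) × Ω => fsq (m.errMat x.1.1 x.1.2 x.2 * m.loadMat x.1.2))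
      (whp atTop P) (𝓝 0) := by
  obtain ⟨K, hK⟩ := h.integral_fsq_errMat_mul_le h2
  refine tendsto_whp_of_integral_le
    (f := fun (p : ℕ × ℕ) ω => fsq (m.errMat p.1 p.2 ω * m.loadMat p.2))
    (b := fun p => K * m.space.mesh p.2) (fun p => measurable_fsq_errMat_mul p.1 p.2)
    (fun _ _ => fsq_nonneg _) ?_ (by simpa using m.tendsto_space_mesh.const_mul K)
  filter_upwards [m.eventually_time_mesh_le_one] with p hp
  exact hK p.1 p.2 hp

theorem D3.tendsto_errGram (h : m.D3) :
    Tendsto (fun x : (ℕ × ℕ) × Ω => fsq (m.errGram x.1.1 x.1.2 x.2)) (whp atTop P) (𝓝 0) := by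
  obtain ⟨K, hK⟩ := h.integral_fsq_errGram_le
  refine tendsto_whp_of_integral_le
    (f := fun (p : ℕ × ℕ) ω => fsq (m.errGram p.1 p.2 ω))
    (b := fun p => K * (m.time.mesh p.1 + m.space.mesh p.2))
    (fun p => measurable_fsq_errGram p.1 p.2) (fun _ _ => fsq_nonneg _) ?_
    (by simpa using (m.tendsto_time_mesh.add m.tendsto_space_mesh).const_mul K)
  filter_upwards [m.eventually_time_mesh_le_one] with p hp
  exact hK p.1 p.2 hp

omit [IsProbabilityMeasure P] in
theorem rate_pos (m : FactorModel P d) (n N : ℕ) : 0 < m.rate n N :=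
  lt_min (inv_pos.2 (Real.sqrt_pos.2 (m.space.mesh_pos N)))
    (inv_pos.2 (Real.sqrt_pos.2 (m.time.mesh_pos n)))

omit [IsProbabilityMeasure P] in
-- Expresses the moment bound `O(ρ + δ)` as `O(rate⁻²)`, the scale on which the penalty is
-- prescribed.
theorem mesh_add_mesh_le (m : FactorModel P d) (n N : ℕ) :
    (m.time.mesh n + m.space.mesh N) * m.rate n N ^ 2 ≤ 2 := by
  have key : ∀ t : ℝ, 0 < t → m.rate n N ≤ (√t)⁻¹ → t * m.rate n N ^ 2 ≤ 1 := fun t ht h => by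
    have h1 : m.rate n N ^ 2 ≤ (√t)⁻¹ ^ 2 := pow_le_pow_left₀ (m.rate_pos n N).le h 2
    rw [inv_pow, Real.sq_sqrt ht.le] at h1
    calc _ ≤ t * t⁻¹ := by gcongr
      _ = 1 := mul_inv_cancel₀ ht.ne'
  have h1 := key _ (m.time.mesh_pos n) (min_le_right _ _)
  have h2 := key _ (m.space.mesh_pos N) (min_le_left _ _)
  linarith

omit [IsProbabilityMeasure P] in
theorem IsPenalty.eventually_pos {q : ℕ → ℕ → ℝ} (hq : m.IsPenalty q) :
    ∀ᶠ p : ℕ × ℕ in atTop, 0 < q p.1 p.2 := by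
  filter_upwards [hq.rate_mul.eventually_gt_atTop 0] with p hp
  exact (mul_pos_iff_of_pos_left (m.rate_pos _ _)).1 hp

theorem D3.tendsto_errGram_div (h : m.D3) {q : ℕ → ℕ → ℝ} (hq : m.IsPenalty q) :
    Tendsto (fun x : (ℕ × ℕ) × Ω => fsq (m.errGram x.1.1 x.1.2 x.2) / q x.1.1 x.1.2 ^ 2)
      (whp atTop P) (𝓝 0) := by
  obtain ⟨K, hK⟩ := h.integral_fsq_errGram_le
  have hlim : Tendsto (fun p : ℕ × ℕ => 2 * |K| * ((m.rate p.1 p.2 * q p.1 p.2)⁻¹) ^ 2) atTop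
      (𝓝 0) := by
    simpa using (hq.rate_mul.inv_tendsto_atTop.pow 2).const_mul (2 * |K|)
  refine tendsto_whp_of_integral_le
    (f := fun (p : ℕ × ℕ) ω => fsq (m.errGram p.1 p.2 ω) / q p.1 p.2 ^ 2)
    (fun p => (measurable_fsq_errGram p.1 p.2).div_const _)
    (fun _ _ => div_nonneg (fsq_nonneg _) (sq_nonneg _)) ?_ hlim
  filter_upwards [m.eventually_time_mesh_le_one, hq.eventually_pos] with p hp hpos
  obtain ⟨h1, h2⟩ := hK p.1 p.2 hp
  refine ⟨h1.div_const _, ?_⟩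
  rw [integral_div, div_le_iff₀ (by positivity)]
  have hr := m.rate_pos p.1 p.2
  have hm := m.mesh_add_mesh_le p.1 p.2
  have h3 : 2 * |K| * ((m.rate p.1 p.2 * q p.1 p.2)⁻¹) ^ 2 * q p.1 p.2 ^ 2 =
      |K| * (2 / m.rate p.1 p.2 ^ 2) := by
    field_simp
  have hmp : 0 ≤ m.time.mesh p.1 + m.space.mesh p.2 :=
    add_nonneg (m.time.mesh_pos _).le (m.space.mesh_pos _).le
  rw [h3]
  refine h2.trans ((mul_le_mul_of_nonneg_right (le_abs_self K) hmp).trans ?_)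
  gcongr
  rwa [le_div_iff₀ (by positivity)]

theorem IsPrincipal.eventually_mu_dim_lt {y : m.Selection} (hy : m.IsPrincipal y) (h : m.D3)
    {q : ℕ → ℕ → ℝ} (hq : m.IsPenalty q) :
    ∀ᶠ x : (ℕ × ℕ) × Ω in whp atTop P, m.mu y x.1.1 x.1.2 x.2 d < q x.1.1 x.1.2 := by
  filter_upwards [(h.tendsto_errGram_div hq).eventually_lt_const zero_lt_one,
    tendsto_fst_whp.eventually hq.eventually_pos] with x hx hpos
  refine (hy.mu_dim_le _ _ _).trans_lt ?_
  rw [Real.sqrt_lt' hpos]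
  rwa [div_lt_one (by positivity)] at hx

/-- The deviation of the scaled data from its low rank part. -/
def remainder (m : FactorModel P d) (n N : ℕ) (ω : Ω) :
    Matrix (Fin (m.time.num n)) (Fin (m.time.num n)) ℝ :=
  m.scaledData n N ω * (m.scaledData n N ω)ᵀ - m.lowRank n ω * (m.lowRank n ω)ᵀ

/-- The restriction to the event supplies the bound on the factor matrix that multiplies the
vanishing terms of `fsq_remainder_le`. -/
theorem tendsto_remainder (h1 : m.D1) (h2 : m.D2) (h3 : m.D3) (k : ℕ) :
    Tendsto (fun x : (ℕ × ℕ) × Ω => fsq (m.remainder x.1.1 x.1.2 x.2))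
      (whp atTop P ⊓ 𝓟 {x | x.2 ∈ m.separatedEvent k}) (𝓝 0) := by
  obtain ⟨K, hK0, hK⟩ := h1.exists_fsq_factorMat_le k
  have hlim : Tendsto (fun x : (ℕ × ℕ) × Ω =>
      4 * (K * fsq ((m.loadMat x.1.2)ᵀ * m.loadMat x.1.2 - m.sigmaLam) * K) +
        8 * (K * fsq (m.errMat x.1.1 x.1.2 x.2 * m.loadMat x.1.2)) +
        4 * fsq (m.errGram x.1.1 x.1.2 x.2)) (whp atTop P) (𝓝 0) := by
    have := ((((h2.tendsto_loadMat).const_mul K).mul_const K).const_mul 4).add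
      (((h3.tendsto_errMat_mul h2).const_mul K).const_mul 8) |>.add
      (h3.tendsto_errGram.const_mul 4)
    simpa using this
  refine tendsto_of_tendsto_of_tendsto_of_le_of_le' tendsto_const_nhds
    (hlim.mono_left inf_le_left) (Eventually.of_forall fun x => fsq_nonneg _) ?_
  filter_upwards [hK] with x hx
  refine (fsq_remainder_le m.rootLam_transpose h2.rootLam_mul_self _ _ _).trans ?_
  have h0 := fsq_nonneg (m.factorMat x.1.1 x.2)
  have h4 := fsq_nonneg ((m.loadMat x.1.2)ᵀ * m.loadMat x.1.2 - m.sigmaLam)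
  have h5 := fsq_nonneg (m.errMat x.1.1 x.1.2 x.2 * m.loadMat x.1.2)
  gcongr

/-! ### Scores of the principal components and consistency of the dimension -/

variable {c : Ω → Fin d → ℝ} {Φ : Ω → Matrix (Fin d) (Fin d) ℝ} {y : m.Selection}

omit [IsProbabilityMeasure P] in
theorem eventually_le_time_num (m : FactorModel P d) :
    ∀ᶠ x : (ℕ × ℕ) × Ω in whp atTop P, d ≤ m.time.num x.1.1 := by
  refine tendsto_fst_whp.eventually (p := fun p : ℕ × ℕ => d ≤ m.time.num p.1) ?_
  rw [← prod_atTop_atTop_eq]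
  exact tendsto_fst.eventually (m.time.eventually_le_num m.T_pos d)

/-- The scores `Σ_λ^{1/2} (√ρ ∑_i Z_{t_i} y^j_{t_i})`. -/
def score (m : FactorModel P d) (y : m.Selection) (n N : ℕ) (ω : Ω) (j : ℕ) : Fin d → ℝ :=
  (m.lowRank n ω)ᵀ *ᵥ m.comp y n N ω j

theorem IsPrincipal.exists_le_mu (hy : m.IsPrincipal y) (h1 : m.D1) (h2 : m.D2) (h3 : m.D3)
    (hΦ : m.IsLimitEigensystem c Φ) (k : ℕ) :
    ∃ κ : ℝ, 0 < κ ∧ ∀ᶠ x : (ℕ × ℕ) × Ω in whp atTop P ⊓ 𝓟 {x | x.2 ∈ m.separatedEvent k},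
      ∀ j : Fin d, κ ≤ m.mu y x.1.1 x.1.2 x.2 j := by
  set β : ℝ := 1 / ((k : ℝ) + 1) with hβdef
  have hβ : 0 < β := by positivity
  -- `β` bounds the eigenvalues of the limit matrix from below; the two approximation errors may use
  -- up a third of it each.
  refine ⟨β / 3, by positivity, ?_⟩
  have e1 := ((h1.tendsto_lowRank_gram.sqrt).mono_left
    (inf_le_left (b := 𝓟 {x : (ℕ × ℕ) × Ω | x.2 ∈ m.separatedEvent k}))).eventually_lt_const
    (u := β / 3) (by simpa using hβ)
  have e2 := ((tendsto_remainder h1 h2 h3 k).sqrt).eventually_lt_const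
    (u := β / 3) (by simpa using hβ)
  filter_upwards [e1, e2, mem_inf_of_left m.eventually_le_time_num,
    mem_inf_of_right (mem_principal_self _)] with x hx1 hx2 hx3 hω j
  have hsep := hΦ.isSeparated h2 hω
  have hsys := hΦ x.2
  have hq : ∀ a, β * (a ⬝ᵥ a) ≤ a ⬝ᵥ (m.rootLam * m.sigmaZ x.2 * m.rootLam) *ᵥ a := fun a => by
    rw [hsys.quadratic_eq, hsys.dotProduct_eq, Finset.mul_sum]
    refine Finset.sum_le_sum fun i _ => ?_
    rw [← sq]
    exact mul_le_mul_of_nonneg_right (hsep.lower i) (sq_nonneg _)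
  have h4 := (hy.eigensystem x.1.1 x.1.2 x.2).le_eigenvalue_low_rank (m.lowRank x.1.1 x.2)
    _ hq (hx1.trans (by linarith)) ⟨j, j.2.trans_le hx3⟩ j.2
  simp only [remainder] at hx2
  linarith

omit [IsProbabilityMeasure P] in
theorem IsPrincipal.score_gram_le (hy : m.IsPrincipal y) {n : ℕ} (hn : d ≤ m.time.num n) (N : ℕ)
    (ω : Ω) (i j : Fin d) :
    |m.score y n N ω i ⬝ᵥ m.score y n N ω j - if i = j then m.mu y n N ω j else 0| ≤
      √(fsq (m.remainder n N ω)) := by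
  have h := (hy.eigensystem n N ω).gram_low_rank (m.lowRank n ω)
    ⟨i, i.2.trans_le hn⟩ ⟨j, j.2.trans_le hn⟩
  rw [score, score, comp_of_lt (i.2.trans_le hn), comp_of_lt (j.2.trans_le hn), remainder]
  simpa only [Fin.mk.injEq, ← Fin.ext_iff] using h

omit [IsProbabilityMeasure P] in
theorem IsPrincipal.score_self_le (hy : m.IsPrincipal y) {n : ℕ} (hn : d ≤ m.time.num n) (N : ℕ)
    (ω : Ω) (j : Fin d) :
    m.score y n N ω j ⬝ᵥ m.score y n N ω j ≤ fsq (m.lowRank n ω) := by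
  refine (mulVec_dotProduct_self_le _ _).trans ?_
  rw [comp_of_lt (j.2.trans_le hn), (hy.eigensystem n N ω).orthonormal, if_pos rfl, mul_one,
    fsq_transpose]

omit [IsProbabilityMeasure P] in
theorem IsPrincipal.score_residual_le (hy : m.IsPrincipal y) {n : ℕ} (hn : d ≤ m.time.num n)
    (N : ℕ) (ω : Ω) (j : Fin d) (H : Matrix (Fin d) (Fin d) ℝ) (l : Fin d) :
    (H *ᵥ m.score y n N ω j - m.mu y n N ω j • m.score y n N ω j) l ^ 2 ≤
      2 * (fsq ((m.lowRank n ω)ᵀ * m.lowRank n ω - H) * fsq (m.lowRank n ω)) +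
        2 * (fsq (m.lowRank n ω) * fsq (m.remainder n N ω)) := by
  have hww := hy.score_self_le hn N ω j
  have hres := (hy.eigensystem n N ω).residual_low_rank (m.lowRank n ω) ⟨j, j.2.trans_le hn⟩
  have hc : m.comp y n N ω j = y n N ω ⟨j, j.2.trans_le hn⟩ := comp_of_lt (j.2.trans_le hn)
  rw [← hc] at hres
  change (((m.lowRank n ω)ᵀ * m.lowRank n ω) *ᵥ m.score y n N ω j -
      m.mu y n N ω j • m.score y n N ω j) ⬝ᵥ (((m.lowRank n ω)ᵀ * m.lowRank n ω) *ᵥ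
        m.score y n N ω j - m.mu y n N ω j • m.score y n N ω j) ≤
      fsq (m.lowRank n ω) * fsq (m.remainder n N ω) at hres
  generalize m.score y n N ω j = w at *
  generalize m.lowRank n ω = A at *
  generalize m.mu y n N ω j = a at *
  -- The first part is controlled by `residual_low_rank`, the second by the convergence of the Gram
  -- matrix.
  have hdec : H *ᵥ w - a • w = ((Aᵀ * A) *ᵥ w - a • w) - (Aᵀ * A - H) *ᵥ w := by
    rw [Matrix.sub_mulVec]; abel
  rw [hdec, Pi.sub_apply]
  have hvv : (Aᵀ * A - H) *ᵥ w ⬝ᵥ (Aᵀ * A - H) *ᵥ w ≤ fsq (Aᵀ * A - H) * fsq A :=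
    (mulVec_dotProduct_self_le _ _).trans (mul_le_mul_of_nonneg_left hww (fsq_nonneg _))
  have hl : ∀ u : Fin d → ℝ, u l ^ 2 ≤ u ⬝ᵥ u := fun u => by
    rw [sq]
    exact Finset.single_le_sum (f := fun l => u l * u l) (fun l _ => mul_self_nonneg _)
      (Finset.mem_univ l)
  have hul := hl ((Aᵀ * A) *ᵥ w - a • w)
  have hvl := hl ((Aᵀ * A - H) *ᵥ w)
  generalize ((Aᵀ * A) *ᵥ w - a • w) = u at *
  generalize (Aᵀ * A - H) *ᵥ w = v at *
  nlinarith [sq_nonneg (u l + v l)]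

omit [IsProbabilityMeasure P] in
theorem IsPrincipal.tendsto_score_of_bounded (hy : m.IsPrincipal y) (h1 : m.D1) (h2 : m.D2)
    (hΦ : m.IsLimitEigensystem c Φ) {F : Filter ((ℕ × ℕ) × Ω)} (hF : F ≤ whp atTop P) {k : ℕ}
    (hω : ∀ᶠ x in F, x.2 ∈ m.separatedEvent k) (hnum : ∀ᶠ x in F, d ≤ m.time.num x.1.1) {κ K : ℝ}
    (hκ : 0 < κ) (hlow : ∀ᶠ x in F, ∀ j : Fin d, κ ≤ m.mu y x.1.1 x.1.2 x.2 j)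
    (hK : ∀ᶠ x in F, fsq (m.lowRank x.1.1 x.2) ≤ K)
    (hR : Tendsto (fun x => fsq (m.remainder x.1.1 x.1.2 x.2)) F (𝓝 0)) (j : Fin d) :
    Tendsto (fun x : (ℕ × ℕ) × Ω =>
      m.score y x.1.1 x.1.2 x.2 j ⬝ᵥ m.score y x.1.1 x.1.2 x.2 j + c x.2 j -
        2 * (√(c x.2 j) * |(Φ x.2)ᵀ j ⬝ᵥ m.score y x.1.1 x.1.2 x.2 j|)) F (𝓝 0) := by
  have hgram : ∀ i j : Fin d, Tendsto (fun x : (ℕ × ℕ) × Ω =>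
      m.score y x.1.1 x.1.2 x.2 i ⬝ᵥ m.score y x.1.1 x.1.2 x.2 j -
        if i = j then m.mu y x.1.1 x.1.2 x.2 j else 0) F (𝓝 0) := fun i j => by
    have hR' := hR.sqrt
    rw [Real.sqrt_zero] at hR'
    refine squeeze_zero_norm' ?_ hR'
    filter_upwards [hnum] with x hx
    exact hy.score_gram_le hx _ _ i j
  have hup : ∀ᶠ x in F, ∀ j : Fin d, m.mu y x.1.1 x.1.2 x.2 j ≤ K + 1 := by
    refine eventually_all.2 fun j => ?_
    -- Eventually `mu j` exceeds the squared length of the score by less than `1`, whence the bound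
    -- `K + 1`.
    filter_upwards [hK, (hgram j j).eventually_const_lt (show (-1 : ℝ) < 0 by norm_num), hnum]
      with x hx1 hx2 hx
    rw [if_pos rfl] at hx2
    linarith [hy.score_self_le hx x.1.2 x.2 j]
  have hHw : ∀ j : Fin d, Tendsto (fun x : (ℕ × ℕ) × Ω =>
      (m.rootLam * m.sigmaZ x.2 * m.rootLam) *ᵥ m.score y x.1.1 x.1.2 x.2 j -
        m.mu y x.1.1 x.1.2 x.2 j • m.score y x.1.1 x.1.2 x.2 j) F (𝓝 0) := fun j => by
    have hsq := ((((h1.tendsto_lowRank_gram.mono_left hF).mul_const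
      K).const_mul 2).add ((hR.const_mul K).const_mul 2)).sqrt
    simp only [zero_mul, mul_zero, add_zero, Real.sqrt_zero] at hsq
    refine tendsto_pi_nhds.2 fun l => squeeze_zero_norm' ?_ hsq
    filter_upwards [hK, hnum] with x hx1 hx
    refine Real.abs_le_sqrt ((hy.score_residual_le hx _ _ j _ l).trans ?_)
    have h4 := fsq_nonneg ((m.lowRank x.1.1 x.2)ᵀ * m.lowRank x.1.1 x.2 -
      m.rootLam * m.sigmaZ x.2 * m.rootLam)
    have h5 := fsq_nonneg (m.remainder x.1.1 x.1.2 x.2)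
    gcongr
  have hsep : ∀ᶠ x in F, IsSeparated (1 / ((k : ℝ) + 1)) ((k : ℝ) + 1) (c x.2) (Φ x.2)ᵀ := by
    filter_upwards [hω] with x hx
    exact hΦ.isSeparated h2 hx
  have hsys : ∀ᶠ x in F, IsOrderedEigensystem (m.rootLam * m.sigmaZ x.2 * m.rootLam)
      (c x.2) (Φ x.2)ᵀ := Eventually.of_forall fun x => hΦ x.2
  have hanti : ∀ᶠ x in F, Antitone fun j : Fin d => m.mu y x.1.1 x.1.2 x.2 j :=
    Eventually.of_forall fun x i j hij => hy.mu_antitone _ _ _ hij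
  have hk : (0 : ℝ) < 1 / ((k : ℝ) + 1) := by positivity
  exact tendsto_eigenvectors (X := (ℕ × ℕ) × Ω) (F := F) (c := fun x : (ℕ × ℕ) × Ω => c x.2)
    (φ := fun x : (ℕ × ℕ) × Ω => (Φ x.2)ᵀ)
    (μ := fun (x : (ℕ × ℕ) × Ω) (j : Fin d) => m.mu y x.1.1 x.1.2 x.2 j)
    (w := fun (x : (ℕ × ℕ) × Ω) (j : Fin d) => m.score y x.1.1 x.1.2 x.2 j)
    (H := fun x : (ℕ × ℕ) × Ω => m.rootLam * m.sigmaZ x.2 * m.rootLam)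
    hk hκ hsep hsys hanti hlow hup hgram hHw j

theorem IsPrincipal.tendsto_score (hy : m.IsPrincipal y) (h1 : m.D1) (h2 : m.D2) (h3 : m.D3)
    (hq1 : m.Q1) (hΦ : m.IsLimitEigensystem c Φ) (j : Fin d) :
    Tendsto (fun x : (ℕ × ℕ) × Ω =>
      m.score y x.1.1 x.1.2 x.2 j ⬝ᵥ m.score y x.1.1 x.1.2 x.2 j + c x.2 j -
        2 * (√(c x.2 j) * |(Φ x.2)ᵀ j ⬝ᵥ m.score y x.1.1 x.1.2 x.2 j|)) (whp atTop P) (𝓝 0) := by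
  refine tendsto_whp_of_exhaustion (hΦ.tendsto_measure_compl_separatedEvent h1 h2 hq1) fun k => ?_
  obtain ⟨κ, hκ, hlow⟩ := hy.exists_le_mu h1 h2 h3 hΦ k
  obtain ⟨K₀, hK₀, hK⟩ := h1.exists_fsq_factorMat_le k
  refine hy.tendsto_score_of_bounded h1 h2 hΦ inf_le_left (mem_inf_of_right (mem_principal_self _))
    (mem_inf_of_left m.eventually_le_time_num) hκ hlow (K := K₀ * fsq m.rootLam) ?_
    (tendsto_remainder h1 h2 h3 k) j
  filter_upwards [hK] with x hx
  exact (fsq_mul_le _ _).trans (mul_le_mul_of_nonneg_right hx (fsq_nonneg _))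

theorem IsPrincipal.eventually_dim_eq (hy : m.IsPrincipal y) (h1 : m.D1) (h2 : m.D2) (h3 : m.D3)
    (hq1 : m.Q1) (hΦ : m.IsLimitEigensystem c Φ) {q : ℕ → ℕ → ℝ} (hq : m.IsPenalty q) {kmax : ℕ}
    {dhat : ℕ → ℕ → Ω → ℕ} (hdhat : m.IsDimEstimator y q kmax dhat) (hd : 1 ≤ d)
    (hkmax : d ≤ kmax) : ∀ᶠ x : (ℕ × ℕ) × Ω in whp atTop P, dhat x.1.1 x.1.2 x.2 = d := by
  refine eventually_whp_of_exhaustion (hΦ.tendsto_measure_compl_separatedEvent h1 h2 hq1)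
    fun k => ?_
  obtain ⟨κ, hκ, hlow⟩ := hy.exists_le_mu h1 h2 h3 hΦ k
  filter_upwards [hlow, mem_inf_of_left (hy.eventually_mu_dim_lt h3 hq),
    mem_inf_of_left (tendsto_fst_whp.eventually (hq.tendsto_zero.eventually_lt_const hκ))]
    with x hx1 hx2 hx3
  exact hy.dim_eq hdhat hd hkmax (hx3.trans_le (hx1 ⟨d - 1, by omega⟩)) hx2

end

end FactorModel

/-! ### The Sobolev seminorm -/

namespace MemSobolev

variable {a b : ℝ} {f g : ℝ → ℝ}

theorem ae_differentiableAt (hf : MemSobolev a b f) (hab : a ≤ b) :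
    ∀ᵐ x ∂volume.restrict (Ioc a b), DifferentiableAt ℝ f x := by
  rw [ae_restrict_iff' measurableSet_Ioc]
  filter_upwards [hf.absCont.ae_differentiableAt] with x hx hmem
  exact hx (by rw [uIcc_of_le hab]; exact Ioc_subset_Icc_self hmem)

theorem memLp_deriv (hf : MemSobolev a b f) (hab : a ≤ b) :
    MemLp (deriv f) 2 (volume.restrict (Ioc a b)) := by
  rw [memLp_two_iff_integrable_sq (measurable_deriv f).aestronglyMeasurable]
  exact (intervalIntegrable_iff_integrableOn_Ioc_of_le hab).1 hf.deriv_sq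

theorem sobolevNorm_eq (hf : MemSobolev a b f) (hab : a ≤ b) :
    sobolevNorm a b f = (eLpNorm (deriv f) 2 (volume.restrict (Ioc a b))).toReal := by
  rw [(hf.memLp_deriv hab).eLpNorm_eq_integral_rpow_norm (by norm_num) (by norm_num),
    ENNReal.toReal_ofReal (by positivity), sobolevNorm, sobolevNormSq,
    intervalIntegral.integral_of_le hab, Real.sqrt_eq_rpow]
  simp

theorem of_deriv_eq (hab : a ≤ b) {u : ℝ → ℝ} (h1 : AbsolutelyContinuousOnInterval u a b)
    (h0 : u a = 0) (hu : MemLp (deriv u) 2 (volume.restrict (Ioc a b))) : MemSobolev a b u :=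
  ⟨h1, h0, (intervalIntegrable_iff_integrableOn_Ioc_of_le hab).2
    ((memLp_two_iff_integrable_sq (measurable_deriv u).aestronglyMeasurable).1 hu)⟩

theorem deriv_add_ae (hf : MemSobolev a b f) (hg : MemSobolev a b g) (hab : a ≤ b) :
    deriv (f + g) =ᵐ[volume.restrict (Ioc a b)] deriv f + deriv g := by
  filter_upwards [hf.ae_differentiableAt hab, hg.ae_differentiableAt hab] with x h1 h2
  exact deriv_add h1 h2

theorem add (hf : MemSobolev a b f) (hg : MemSobolev a b g) (hab : a ≤ b) :
    MemSobolev a b (f + g) :=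
  of_deriv_eq hab (hf.absCont.add hg.absCont) (by simp [hf.zero_left, hg.zero_left])
    ((memLp_congr_ae (hf.deriv_add_ae hg hab)).2 ((hf.memLp_deriv hab).add (hg.memLp_deriv hab)))

theorem const_mul (hf : MemSobolev a b f) (r : ℝ) (hab : a ≤ b) :
    MemSobolev a b (fun x => r * f x) := by
  refine of_deriv_eq hab (hf.absCont.const_mul r) (by simp [hf.zero_left]) ?_
  have : deriv (fun x => r * f x) = fun x => r * deriv f x := by
    ext x; exact deriv_const_mul_field r
  rw [this]
  exact (hf.memLp_deriv hab).const_mul r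

/-- Minkowski's inequality in `L²` for the derivatives. `deriv` is additive only where both
functions are differentiable, which absolute continuity provides almost everywhere. -/
theorem sobolevNorm_add_le (hf : MemSobolev a b f) (hg : MemSobolev a b g) (hab : a ≤ b) :
    sobolevNorm a b (f + g) ≤ sobolevNorm a b f + sobolevNorm a b g := by
  rw [(hf.add hg hab).sobolevNorm_eq hab, hf.sobolevNorm_eq hab, hg.sobolevNorm_eq hab,
    eLpNorm_congr_ae (hf.deriv_add_ae hg hab),
    ← ENNReal.toReal_add (hf.memLp_deriv hab).eLpNorm_ne_top (hg.memLp_deriv hab).eLpNorm_ne_top]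
  refine ENNReal.toReal_mono ?_ (eLpNorm_add_le (hf.memLp_deriv hab).1 (hg.memLp_deriv hab).1
    (by norm_num))
  exact ENNReal.add_ne_top.2
    ⟨(hf.memLp_deriv hab).eLpNorm_ne_top, (hg.memLp_deriv hab).eLpNorm_ne_top⟩

theorem sobolevNorm_const_mul (a b : ℝ) (f : ℝ → ℝ) (r : ℝ) :
    sobolevNorm a b (fun x => r * f x) = |r| * sobolevNorm a b f := by
  have : deriv (fun x => r * f x) = fun x => r * deriv f x := by
    ext x; exact deriv_const_mul_field r
  simp only [sobolevNorm, sobolevNormSq, this, mul_pow, intervalIntegral.integral_const_mul]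
  rw [Real.sqrt_mul (sq_nonneg r), Real.sqrt_sq_eq_abs]

theorem zero (hab : a ≤ b) : MemSobolev a b (fun _ => 0) := by
  refine of_deriv_eq hab ?_ rfl (by simp)
  have h := (LipschitzWith.const' (α := ℝ) (0 : ℝ) (K := 0)).lipschitzOnWith
    (s := uIcc a b)
  exact h.absolutelyContinuousOnInterval

theorem sum_memSobolev_and_le {ι : Type*} (s : Finset ι) {f : ι → ℝ → ℝ} (α : ι → ℝ)
    (hf : ∀ i ∈ s, MemSobolev a b (f i)) (hab : a ≤ b) :
    MemSobolev a b (fun x => ∑ i ∈ s, α i * f i x) ∧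
      sobolevNorm a b (fun x => ∑ i ∈ s, α i * f i x) ≤ ∑ i ∈ s, |α i| * sobolevNorm a b (f i) := by
  classical
  induction s using Finset.induction_on with
  | empty =>
    refine ⟨by simpa using zero hab, ?_⟩
    simp [sobolevNorm, sobolevNormSq]
  | insert i s hi ih =>
    obtain ⟨h1, h2⟩ := ih fun j hj => hf j (Finset.mem_insert_of_mem hj)
    have h3 := (hf i (Finset.mem_insert_self i s)).const_mul (α i) hab
    have heq : (fun x => ∑ j ∈ insert i s, α j * f j x) =
        (fun x => α i * f i x) + fun x => ∑ j ∈ s, α j * f j x := by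
      ext x; simp [Finset.sum_insert hi]
    rw [heq, Finset.sum_insert hi]
    refine ⟨h3.add h1 hab, (h3.sobolevNorm_add_le h1 hab).trans ?_⟩
    rw [sobolevNorm_const_mul]
    gcongr

theorem sobolevNormSq_nonneg (hab : a ≤ b) (f : ℝ → ℝ) : 0 ≤ sobolevNormSq a b f :=
  intervalIntegral.integral_nonneg hab fun _ _ => sq_nonneg _

theorem sobolevNorm_sq (hab : a ≤ b) (f : ℝ → ℝ) :
    sobolevNorm a b f ^ 2 = sobolevNormSq a b f := Real.sq_sqrt (sobolevNormSq_nonneg hab f)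

end MemSobolev

theorem Finset.sq_sum_eq_diag_add {k : ℕ} (a : Fin k → ℝ) :
    (∑ i, a i) ^ 2 = ∑ i, a i ^ 2 + 2 * ∑ i, ∑ j, if i < j then a i * a j else 0 := by
  have h1 : ∀ i j, a i * a j = (if i = j then a i ^ 2 else 0) +
      (if i < j then a i * a j else 0) + if j < i then a j * a i else 0 := fun i j => by
    rcases lt_trichotomy i j with h | h | h
    · simp [h, h.ne, h.not_gt]
    · subst h; simp [sq]
    · simp [h, h.ne', h.not_gt, mul_comm]
  rw [sq, Finset.sum_mul_sum, Finset.sum_congr rfl fun i _ => Finset.sum_congr rfl fun j _ => h1 i j]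
  simp only [Finset.sum_add_distrib]
  rw [Finset.sum_comm (f := fun i j => if j < i then a j * a i else 0)]
  simp
  ring

/-! ### Convergence of the estimated loadings -/

namespace FactorModel

variable {Ω : Type*} [MeasurableSpace Ω] {P : Measure Ω} {d : ℕ} {m : FactorModel P d}
variable {y : m.Selection} {c : Ω → Fin d → ℝ} {Φ : Ω → Matrix (Fin d) (Fin d) ℝ}

/-- The orientation that makes the `j`-th score and the `j`-th limiting eigenvector form an acute
angle. -/
def orientation (m : FactorModel P d) (y : m.Selection) (Φ : Ω → Matrix (Fin d) (Fin d) ℝ)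
    (n N : ℕ) (ω : Ω) (j : ℕ) : ℝ :=
  if h : j < d then
    if 0 ≤ (Φ ω)ᵀ ⟨j, h⟩ ⬝ᵥ m.score y n N ω j then 1 else -1
  else 1

theorem orientation_eq (n N : ℕ) (ω : Ω) (j : ℕ) :
    m.orientation y Φ n N ω j = 1 ∨ m.orientation y Φ n N ω j = -1 := by
  unfold orientation
  split_ifs <;> simp

theorem orientation_mul (n N : ℕ) (ω : Ω) (j : Fin d) :
    m.orientation y Φ n N ω j * ((Φ ω)ᵀ j ⬝ᵥ m.score y n N ω j) =
      |(Φ ω)ᵀ j ⬝ᵥ m.score y n N ω j| := by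
  rw [orientation, dif_pos j.2, Fin.eta]
  split_ifs with h
  · rw [one_mul, abs_of_nonneg h]
  · rw [neg_one_mul, abs_of_neg (not_le.1 h)]

/-- Shows that `ξ_j` has the `λ`-coefficients `√c_j Σ_λ^{-1/2} φ_j`, in the form in which they
compare with the scores. -/
theorem IsLimitEigensystem.rotation_inv (hΦ : m.IsLimitEigensystem c Φ) (h2 : m.D2) {ω : Ω}
    (hc : ∀ j, 0 < c ω j) :
    (m.rotation (c ω) (Φ ω))⁻¹ = m.rootLam⁻¹ * Φ ω * Matrix.diagonal fun j => √(c ω j) := by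
  have hu := h2.isUnit_det_rootLam
  refine Matrix.inv_eq_right_inv ?_
  have hΦ1 : (Φ ω)ᵀ * Φ ω = 1 := (hΦ ω).of_mul_transpose
  have hdiag : Matrix.diagonal (fun i => (c ω i)⁻¹) * Matrix.diagonal (fun i => √(c ω i)) *
      Matrix.diagonal (fun i => √(c ω i)) = (1 : Matrix (Fin d) (Fin d) ℝ) := by
    rw [Matrix.diagonal_mul_diagonal, Matrix.diagonal_mul_diagonal, ← Matrix.diagonal_one]
    congr 1
    ext i
    rw [mul_assoc, Real.mul_self_sqrt (hc i).le, inv_mul_cancel₀ (hc i).ne']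
  calc _ = Matrix.diagonal (fun i => (c ω i)⁻¹) * Matrix.diagonal (fun i => √(c ω i)) *
        ((Φ ω)ᵀ * ((m.rootLam⁻¹ * m.rootLam) * (m.rootLam * m.rootLam⁻¹)) * Φ ω) *
        Matrix.diagonal (fun i => √(c ω i)) := by
        simp only [rotation, G, ← h2.rootLam_mul_self, Matrix.mul_assoc]
    _ = 1 := by
        rw [Matrix.nonsing_inv_mul _ hu, Matrix.mul_nonsing_inv _ hu, Matrix.mul_one,
          Matrix.mul_one, hΦ1, Matrix.mul_one, hdiag]

/-- Coefficients of the estimation error with respect to the loadings. -/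
def coeffDev (m : FactorModel P d) (y : m.Selection) (c : Ω → Fin d → ℝ)
    (Φ : Ω → Matrix (Fin d) (Fin d) ℝ) (n N : ℕ) (ω : Ω) (j : Fin d) : Fin d → ℝ :=
  m.rootLam⁻¹ *ᵥ (m.orientation y Φ n N ω j • m.score y n N ω j - √(c ω j) • (Φ ω)ᵀ j)

/-- With the chosen orientation `s`, the last factor is exactly `‖s w_j - √c_j φ_j‖²`, the quantity
that `tendsto_score` sends to zero. -/
theorem IsLimitEigensystem.coeffDev_le (hΦ : m.IsLimitEigensystem c Φ) (n N : ℕ) {ω : Ω}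
    (hc : ∀ j, 0 < c ω j) (j : Fin d) :
    m.coeffDev y c Φ n N ω j ⬝ᵥ m.coeffDev y c Φ n N ω j ≤ fsq m.rootLam⁻¹ *
      (m.score y n N ω j ⬝ᵥ m.score y n N ω j + c ω j -
        2 * (√(c ω j) * |(Φ ω)ᵀ j ⬝ᵥ m.score y n N ω j|)) := by
  refine (mulVec_dotProduct_self_le _ _).trans_eq ?_
  congr 1
  have h1 := (hΦ ω).orthonormal j j
  rw [if_pos rfl] at h1
  have h2 := orientation_mul (m := m) (y := y) (Φ := Φ) n N ω j
  have h3 := Real.mul_self_sqrt (hc j).le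
  have h4 : m.orientation y Φ n N ω j * m.orientation y Φ n N ω j = 1 := by
    rcases orientation_eq (m := m) (y := y) (Φ := Φ) n N ω j with h | h <;> simp [h]
  rw [← h2]
  simp only [sub_dotProduct, dotProduct_sub, smul_dotProduct, dotProduct_smul, smul_eq_mul, h1,
    mul_one, dotProduct_comm (m.score y n N ω j) ((Φ ω)ᵀ j)]
  linear_combination (m.score y n N ω j ⬝ᵥ m.score y n N ω j) * h4 + h3

/-- Inserting the model into `phiHat` gives the loadings with coefficients `Fᵀ y_j = Σ_λ^{-1/2}
w_j`, plus the error curves weighted by `√ρ y_j`. -/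
theorem IsLimitEigensystem.phiHat_sub_xi (hΦ : m.IsLimitEigensystem c Φ) (h2 : m.D2) (n N : ℕ)
    {ω : Ω} (hc : ∀ j, 0 < c ω j) (j : Fin d) (x : ℝ) :
    m.orientation y Φ n N ω j * m.phiHat y n N ω j x - m.xi (c ω) (Φ ω) j x =
      ∑ l, m.coeffDev y c Φ n N ω j l * m.lam l x +
        ∑ k, (m.orientation y Φ n N ω j * √(m.time.mesh n) * m.comp y n N ω j k) *
          m.eps n N (m.time.pt n k) ω x := by
  set s := m.orientation y Φ n N ω j
  have hu := h2.isUnit_det_rootLam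
  have hxi : m.xi (c ω) (Φ ω) j x = ∑ l, √(c ω j) * (m.rootLam⁻¹ *ᵥ (Φ ω)ᵀ j) l * m.lam l x := by
    rw [xi, dif_pos j.2, hΦ.rotation_inv h2 hc]
    simp only [Matrix.mulVec, dotProduct, Fin.eta, Matrix.transpose_apply, Matrix.mul_diagonal]
    exact Finset.sum_congr rfl fun l _ => by rw [Matrix.mul_apply]; ring
  have hscore : m.rootLam⁻¹ *ᵥ m.score y n N ω j = (m.factorMat n ω)ᵀ *ᵥ m.comp y n N ω j := by
    rw [score, lowRank, Matrix.transpose_mul, m.rootLam_transpose, Matrix.mulVec_mulVec,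
      Matrix.nonsing_inv_mul_cancel_left _ _ hu]
  have hdev : ∀ l, m.coeffDev y c Φ n N ω j l =
      s * ((m.factorMat n ω)ᵀ *ᵥ m.comp y n N ω j) l -
        √(c ω j) * (m.rootLam⁻¹ *ᵥ (Φ ω)ᵀ j) l := fun l => by
    rw [coeffDev, Matrix.mulVec_sub, Matrix.mulVec_smul, Matrix.mulVec_smul, hscore]
    rfl
  have hphi : m.phiHat y n N ω j x =
      ∑ l, ((m.factorMat n ω)ᵀ *ᵥ m.comp y n N ω j) l * m.lam l x +
        ∑ k, √(m.time.mesh n) * m.comp y n N ω j k * m.eps n N (m.time.pt n k) ω x := by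
    simp only [Matrix.mulVec, dotProduct, Finset.sum_mul, Matrix.transpose_apply, factorMat,
      Matrix.of_apply]
    rw [Finset.sum_comm, ← Finset.sum_add_distrib, phiHat, Finset.mul_sum]
    refine Finset.sum_congr rfl fun k _ => ?_
    have : m.obs n N (m.time.pt n k) ω x =
        ∑ l, m.Zs n k ω l * m.lam l x + m.eps n N (m.time.pt n k) ω x := by
      simp only [obs, r, Zs]; ring
    rw [this, mul_add, mul_add, Finset.mul_sum, Finset.mul_sum]
    congr 1
    · exact Finset.sum_congr rfl fun l _ => by ring
    · ring
  rw [hphi, hxi]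
  simp only [hdev, sub_mul, Finset.sum_sub_distrib, mul_add, Finset.mul_sum, mul_assoc]
  ring

theorem abs_orientation (n N : ℕ) (ω : Ω) (j : ℕ) : |m.orientation y Φ n N ω j| = 1 := by
  rcases orientation_eq (m := m) (y := y) (Φ := Φ) n N ω j with h | h <;> simp [h]

/-- The off-diagonal part of the squared norm of the estimation error caused by the errors. -/
def crossErr (m : FactorModel P d) (y : m.Selection) (n N : ℕ) (ω : Ω) (j : ℕ) : ℝ :=
  m.time.mesh n * ∑ l, ∑ s, if l < s then
    |m.comp y n N ω j l * m.comp y n N ω j s| * m.errNorm n N l ω * m.errNorm n N s ω else 0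

/-- The diagonal part of the squared norm of the estimation error caused by the errors. -/
def diagErr (m : FactorModel P d) (y : m.Selection) (n N : ℕ) (ω : Ω) (j : ℕ) : ℝ :=
  m.time.mesh n * ∑ l, m.comp y n N ω j l ^ 2 * m.errNorm n N l ω ^ 2

theorem sq_sum_err_eq (n N : ℕ) (ω : Ω) (j : ℕ) :
    (∑ k, √(m.time.mesh n) * |m.comp y n N ω j k| * m.errNorm n N k ω) ^ 2 =
      m.diagErr y n N ω j + 2 * m.crossErr y n N ω j := by
  have h1 := Real.mul_self_sqrt (m.time.mesh_pos n).le
  rw [Finset.sq_sum_eq_diag_add, diagErr, crossErr]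
  congr 1
  · rw [Finset.mul_sum]
    refine Finset.sum_congr rfl fun k _ => ?_
    rw [mul_pow, mul_pow, sq_abs, sq √(m.time.mesh n), h1]; ring
  · congr 1
    rw [Finset.mul_sum]
    refine Finset.sum_congr rfl fun k _ => ?_
    rw [Finset.mul_sum]
    refine Finset.sum_congr rfl fun l _ => ?_
    split_ifs
    · rw [abs_mul]
      calc _ = (√(m.time.mesh n) * √(m.time.mesh n)) * (|m.comp y n N ω j k| *
            |m.comp y n N ω j l| * m.errNorm n N k ω * m.errNorm n N l ω) := by ring
        _ = _ := by rw [h1]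
    · simp

theorem IsLimitEigensystem.sobolevNormSq_phiHat_sub_xi_le (hΦ : m.IsLimitEigensystem c Φ)
    (h2 : m.D2) (n N : ℕ) {ω : Ω} (hc : ∀ j, 0 < c ω j) (j : Fin d) :
    sobolevNormSq m.a m.b (fun x =>
        m.orientation y Φ n N ω j * m.phiHat y n N ω j x - m.xi (c ω) (Φ ω) j x) ≤
      2 * (fsq m.rootLam⁻¹ * (m.score y n N ω j ⬝ᵥ m.score y n N ω j + c ω j -
        2 * (√(c ω j) * |(Φ ω)ᵀ j ⬝ᵥ m.score y n N ω j|)) *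
          ∑ l, sobolevNorm m.a m.b (m.lam l) ^ 2) +
      2 * (m.diagErr y n N ω j + 2 * m.crossErr y n N ω j) := by
  have hab := m.a_lt_b.le
  obtain ⟨h3, h4⟩ := MemSobolev.sum_memSobolev_and_le (a := m.a) (b := m.b) Finset.univ
    (m.coeffDev y c Φ n N ω j) (fun l _ => m.lam_mem l) hab
  obtain ⟨h5, h6⟩ := MemSobolev.sum_memSobolev_and_le (a := m.a) (b := m.b) Finset.univ
    (fun k => m.orientation y Φ n N ω j * √(m.time.mesh n) * m.comp y n N ω j k)
    (fun k _ => m.eps_mem n N _ (m.time.pt_mem n k) ω) hab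
  have h7 := h3.sobolevNorm_add_le h5 hab
  rw [show (fun x => m.orientation y Φ n N ω j * m.phiHat y n N ω j x - m.xi (c ω) (Φ ω) j x) = _
    from funext fun x => hΦ.phiHat_sub_xi h2 n N hc j x, ← MemSobolev.sobolevNorm_sq hab]
  have h8 : ∑ k, |m.orientation y Φ n N ω j * √(m.time.mesh n) * m.comp y n N ω j k| *
      sobolevNorm m.a m.b (m.eps n N (m.time.pt n k) ω) =
      ∑ k, √(m.time.mesh n) * |m.comp y n N ω j k| * m.errNorm n N k ω :=
    Finset.sum_congr rfl fun k _ => by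
      rw [abs_mul, abs_mul, abs_orientation, one_mul, abs_of_nonneg (Real.sqrt_nonneg _)]
      rfl
  rw [h8] at h6
  have h9 : (∑ l, |m.coeffDev y c Φ n N ω j l| * sobolevNorm m.a m.b (m.lam l)) ^ 2 ≤
      (m.coeffDev y c Φ n N ω j ⬝ᵥ m.coeffDev y c Φ n N ω j) *
        ∑ l, sobolevNorm m.a m.b (m.lam l) ^ 2 := by
    refine (Finset.sum_mul_sq_le_sq_mul_sq _ _ _).trans_eq ?_
    simp [dotProduct, sq]
  have h10 : 0 ≤ ∑ l, sobolevNorm m.a m.b (m.lam l) ^ 2 := by positivity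
  have h11 := mul_le_mul_of_nonneg_right (hΦ.coeffDev_le (y := y) n N hc j) h10
  rw [← sq_sum_err_eq]
  refine (pow_le_pow_left₀ (Real.sqrt_nonneg _) (h7.trans (add_le_add h4 h6)) 2).trans
    (add_sq_le.trans ?_)
  rw [mul_add]
  exact add_le_add (mul_le_mul_of_nonneg_left (h9.trans h11) zero_le_two) le_rfl

/-- Where all `‖ε_t‖²` are at most `K`, normalization of the component bounds the diagonal part by
`ρ |K|`. -/
theorem IsPrincipal.tendsto_diagErr (hy : m.IsPrincipal y) (h5 : m.Q5 y) (j : ℕ) :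
    Tendsto (fun x : (ℕ × ℕ) × Ω => m.diagErr y x.1.1 x.1.2 x.2 j) (whp atTop P) (𝓝 0) := by
  rw [Metric.tendsto_nhds]
  intro ε hε
  refine eventually_whp_of_le fun η hη => ?_
  obtain ⟨K, hK⟩ := h5.bounded η hη
  have hlim := m.tendsto_time_mesh.mul_const |K|
  rw [zero_mul] at hlim
  filter_upwards [hlim.eventually_lt_const hε] with p hp
  refine (measure_mono fun ω hω => ?_).trans (hK p.1 p.2)
  by_contra hno
  refine hω ?_
  have hno' : ∀ t ∈ Icc 0 m.T, sobolevNormSq m.a m.b (m.eps p.1 p.2 t ω) ≤ K := by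
    simpa using hno
  have hρ := m.time.mesh_pos p.1
  have hnn : 0 ≤ m.diagErr y p.1 p.2 ω j := by
    unfold diagErr; positivity
  rw [Real.dist_eq, sub_zero, abs_of_nonneg hnn]
  refine lt_of_le_of_lt ?_ hp
  refine mul_le_mul_of_nonneg_left ?_ hρ.le
  have hle : ∑ l, m.comp y p.1 p.2 ω j l ^ 2 * m.errNorm p.1 p.2 l ω ^ 2 ≤
      ∑ l, m.comp y p.1 p.2 ω j l ^ 2 * |K| := by
    gcongr with l _
    rw [errNorm, MemSobolev.sobolevNorm_sq m.a_lt_b.le]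
    exact (hno' _ (m.time.pt_mem _ _)).trans (le_abs_self K)
  refine hle.trans ?_
  rw [← Finset.sum_mul]
  have hone : ∑ l, m.comp y p.1 p.2 ω j l ^ 2 ≤ 1 := by
    rcases hy.comp_normalized p.1 p.2 ω j with h | h
    · simp [h]
    · simp only [dotProduct, ← sq] at h
      exact h.le
  exact mul_le_of_le_one_left (abs_nonneg K) hone

theorem Q5.tendsto_crossErr (h5 : m.Q5 y) (j : Fin d) :
    Tendsto (fun x : (ℕ × ℕ) × Ω => m.crossErr y x.1.1 x.1.2 x.2 j) (whp atTop P) (𝓝 0) := by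
  have h := tendstoInMeasure_iff_whp.1 (h5.tendsto j)
  simp only [sub_zero] at h
  exact h

theorem IsPrincipal.tendsto_phiHat [IsProbabilityMeasure P] (hy : m.IsPrincipal y) (h1 : m.D1)
    (h2 : m.D2) (h3 : m.D3) (hq1 : m.Q1) (h5 : m.Q5 y) (hΦ : m.IsLimitEigensystem c Φ)
    (j : Fin d) :
    Tendsto (fun x : (ℕ × ℕ) × Ω => sobolevNormSq m.a m.b fun t =>
        m.orientation y Φ x.1.1 x.1.2 x.2 j * m.phiHat y x.1.1 x.1.2 x.2 j t -
          m.xi (c x.2) (Φ x.2) j t) (whp atTop P) (𝓝 0) := by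
  have hlim := ((((hy.tendsto_score h1 h2 h3 hq1 hΦ j).const_mul (fsq m.rootLam⁻¹)).mul_const
    (∑ l, sobolevNorm m.a m.b (m.lam l) ^ 2)).const_mul 2).add
    (((hy.tendsto_diagErr h5 j).add ((h5.tendsto_crossErr j).const_mul 2)).const_mul 2)
  simp only [mul_zero, zero_mul, add_zero] at hlim
  refine tendsto_of_tendsto_of_tendsto_of_le_of_le' tendsto_const_nhds hlim
    (Eventually.of_forall fun x => MemSobolev.sobolevNormSq_nonneg m.a_lt_b.le _) ?_
  filter_upwards [eventually_whp_of_ae h1.posDef] with x hx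
  exact hΦ.sobolevNormSq_phiHat_sub_xi_le h2 _ _ (hΦ.pos h2 hx) j

end FactorModel

end

theorem proposition6 {Ω : Type*} [MeasurableSpace Ω] (P : Measure Ω) [IsProbabilityMeasure P]
    (d : ℕ) (hd : 1 ≤ d) (m : FactorModel P d)
    (hD1 : m.D1) (hD2 : m.D2) (hD3 : m.D3) (hD4 : m.D4) (hQ1 : m.Q1)
    (y : m.Selection) (hy : m.IsPrincipal y) (hQ5 : m.Q5 y)
    (q : ℕ → ℕ → ℝ) (hq : m.IsPenalty q) (kmax : ℕ) (hkmax : d ≤ kmax)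
    (dhat : ℕ → ℕ → Ω → ℕ) (hdhat : m.IsDimEstimator y q kmax dhat)
    (c : Ω → Fin d → ℝ) (Φ : Ω → Matrix (Fin d) (Fin d) ℝ) (hΦ : m.IsLimitEigensystem c Φ) :
    Tendsto (fun p : ℕ × ℕ => P {ω | dhat p.1 p.2 ω ≠ d}) atTop (𝓝 0) ∧
    -- eigenvectors are determined only up to sign: `s` orients them
    ∃ s : ℕ → ℕ → Ω → ℕ → ℝ, (∀ n N ω j, s n N ω j = 1 ∨ s n N ω j = -1) ∧
      TendstoInMeasure P
        (fun (p : ℕ × ℕ) ω => ∑ j ∈ Finset.range (dhat p.1 p.2 ω),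
          sobolevNormSq m.a m.b fun x =>
            s p.1 p.2 ω j * m.phiHat y p.1 p.2 ω j x - m.xi (c ω) (Φ ω) j x)
        atTop (fun _ => 0) := by
  have hdim := hy.eventually_dim_eq hD1 hD2 hD3 hQ1 hΦ hq hdhat hd hkmax
  refine ⟨eventually_whp.1 hdim, m.orientation y Φ,
    fun n N ω j => FactorModel.orientation_eq n N ω j, ?_⟩
  rw [tendstoInMeasure_iff_whp]
  have hlim : Tendsto (fun x : (ℕ × ℕ) × Ω => ∑ j : Fin d, sobolevNormSq m.a m.b fun t =>
      m.orientation y Φ x.1.1 x.1.2 x.2 j * m.phiHat y x.1.1 x.1.2 x.2 j t -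
        m.xi (c x.2) (Φ x.2) j t) (whp atTop P) (𝓝 (∑ _j : Fin d, 0)) :=
    tendsto_finsetSum _ fun j _ => hy.tendsto_phiHat hD1 hD2 hD3 hQ1 hQ5 hΦ j
  rw [Finset.sum_const_zero] at hlim
  -- Only on the event `dhat = d` does the random range of summation agree with `Fin d`; that event
  -- belongs to `whp`.
  refine hlim.congr' ?_
  filter_upwards [hdim] with x hx
  rw [hx, sub_zero, Finset.sum_range]
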